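/- Let $\sigma$ be a finite relational vocabulary and let $\varphi$ be a fixed formula of inclusion logic $\mathrm{FO}(\subseteq)$ over $\sigma$, that is, a formula built from the literals $x=y$, $x\neq y$, $R(\bar x)$, $\neg R(\bar x)$ and the inclusion atoms $\bar x\subseteq\bar y$ (with $\bar x,\bar y$ of the same length) by $\wedge,\vee,\exists x,\forall x$, interpreted in (lax) team semantics. For a finite $\sigma$-structure $\mathcal A$ with universe $A$, consider teams $X$ of $\mathcal A$ whose domain is the set $\mathrm{Fr}(\varphi)$ of free variables of $\varphi$, i.e. sets of assignments $\mathrm{Fr}(\varphi)\to A$. Let $\mathrm{EMaxSAT}_\varphi$ be the problem to enumerate, given a finite $\sigma$-structure $\mathcal A$, all teams $X\neq\emptyset$ with $\mathcal A\models_X\varphi$ such that $\mathcal A\not\models_{X'}\varphi$ for all teams $X'\supsetneq X$. Let $\mathrm{ECardMaxSAT}_\varphi$ be the problem to enumerate, given $\mathcal A$, all teams $X\neq\emptyset$ with $\mathcal A\models_X\varphi$ such that $\mathcal A\not\models_{X'}\varphi$ for all teams $X'$ with $|X'|>|X|$. Let $\mathrm{DelP}$ be the class of enumeration problems $E$ for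 which there are a random access machine $M$ (with logarithmic cost), an oracle language $L\in\mathrm P$ and a polynomial $p$ such that on every input word $x$, $M$ with oracle $L$ outputs the solutions of $E$ on $x$, each exactly once, and halts; the time before the first output, between two consecutive outputs, and from the last output until halting is at most $p(|x|)$, and all oracle queries have length at most $p(|x|)$. Structures and teams are coded by binary words: a structure with universe $\{0,\dots,n-1\}$ by $1^n0$ followed by the characteristic words of its relations, a team by the characteristic word of its set of value tuples; a word that codes no structure has no solutions. **Theorem.** $\mathrm{EMaxSAT}_\varphi\in\mathrm{DelP}$ and $\mathrm{ECardMaxSAT}_\varphi\in\mathrm{DelP}$. Moreover, for every finite $\sigma$-structure $\mathcal A$ there is, among all teams $X$ with domain $\mathrm{Fr}(\varphi)$ and $\mathcal A\models_X\varphi$ (the empty team included), a greatest one $T_{\mathcal A}$ with respect to inclusion; for both problems the solution set on $\mathcal A$ is $\{T_{\mathcal A}\}$ if $T_{\mathcal A}\neq\emptyset$ and is empty otherwise; and $T_{\mathcal A}$ is computable from $\mathcal A$ in polynomial time (by a random access machine without oracle). -/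

import Mathlib

namespace TeamEnum

/-! ### First-order team logic with inclusion atoms -/

/-- A finite relational vocabulary: finitely many relation symbols with positive arities. -/
structure Vocabulary where
  numRel : ℕ
  arity : Fin numRel → ℕ
  arity_pos : ∀ i, 0 < arity i

/-- A structure over the vocabulary `σ` with universe `A`. -/
structure Struct (σ : Vocabulary) (A : Type) where
  rel : (i : Fin σ.numRel) → Set (Fin (σ.arity i) → A)

/-- Formulas of inclusion logic over `σ`; the first-order variables are the natural numbers. -/
inductive InclFormula (σ : Vocabulary) : Type
  | eq (x y : ℕ)
  | neq (x y : ℕ)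
  | rel (i : Fin σ.numRel) (x : Fin (σ.arity i) → ℕ)
  | nrel (i : Fin σ.numRel) (x : Fin (σ.arity i) → ℕ)
  | incl (m : ℕ) (x y : Fin m → ℕ)
  | and (φ ψ : InclFormula σ)
  | or (φ ψ : InclFormula σ)
  | ex (x : ℕ) (φ : InclFormula σ)
  | all (x : ℕ) (φ : InclFormula σ)

/-- The free variables of a formula. -/
def InclFormula.free {σ : Vocabulary} : InclFormula σ → Finset ℕ
  | .eq x y => {x, y}
  | .neq x y => {x, y}
  | .rel _ x => Finset.univ.image x
  | .nrel _ x => Finset.univ.image x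
  | .incl _ x y => Finset.univ.image x ∪ Finset.univ.image y
  | .and φ ψ => φ.free ∪ ψ.free
  | .or φ ψ => φ.free ∪ ψ.free
  | .ex x φ => φ.free.erase x
  | .all x φ => φ.free.erase x

/-- Assignments with codomain `A`, as partial functions on the variables: the domain of `s` is
the set of variables `v` with `s v ≠ none`. -/
abbrev Assignment (A : Type) : Type := ℕ → Option A

/-- The assignment `s(a/x)`, with domain `D ∪ {x}` if `s` has domain `D`. -/
def Assignment.supp {A : Type} (s : Assignment A) (x : ℕ) (a : A) : Assignment A :=
  Function.update s x (some a)

/-- The full team with domain `D`: all assignments from `D` to `A`. -/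
def fullTeam (D : Finset ℕ) (A : Type) : Set (Assignment A) :=
  {s | ∀ v, s v ≠ none ↔ v ∈ D}

/-- A team with domain `D` and codomain `A`: a finite set of assignments from `D` to `A`. -/
def IsTeam {A : Type} (D : Finset ℕ) (X : Set (Assignment A)) : Prop :=
  X.Finite ∧ X ⊆ fullTeam D A

/-- The team `X[F/x]`. -/
def supplement {A : Type} (X : Set (Assignment A)) (x : ℕ) (F : Assignment A → Set A) :
    Set (Assignment A) :=
  {t | ∃ s ∈ X, ∃ a ∈ F s, t = s.supp x a}

/-- Team semantics (lax). It is used for sets `X` of assignments whose common domain contains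
the free variables of the formula. -/
def Sat {σ : Vocabulary} {A : Type} (S : Struct σ A) :
    InclFormula σ → Set (Assignment A) → Prop
  | .eq x y, X => ∀ s ∈ X, s x = s y
  | .neq x y, X => ∀ s ∈ X, s x ≠ s y
  | .rel i x, X => ∀ s ∈ X, ∃ a ∈ S.rel i, ∀ j, s (x j) = some (a j)
  | .nrel i x, X => ∀ s ∈ X, ¬ ∃ a ∈ S.rel i, ∀ j, s (x j) = some (a j)
  | .incl _ x y, X => ∀ s ∈ X, ∃ t ∈ X, ∀ j, s (x j) = t (y j)
  | .and φ ψ, X => Sat S φ X ∧ Sat S ψ X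
  | .or φ ψ, X => ∃ Y Z, Y ⊆ X ∧ Z ⊆ X ∧ Y ∪ Z = X ∧ Sat S φ Y ∧ Sat S ψ Z
  | .ex x φ, X => ∃ F : Assignment A → Set A, (∀ s ∈ X, (F s).Nonempty) ∧
      Sat S φ (supplement X x F)
  | .all x φ, X => Sat S φ (supplement X x (fun _ => Set.univ))

/-- The satisfying teams of `φ` in `S`, over the domain of free variables of `φ`
(the empty team included). -/
def satTeams {σ : Vocabulary} {A : Type} (φ : InclFormula σ) (S : Struct σ A) :
    Set (Set (Assignment A)) :=
  {X | IsTeam φ.free X ∧ Sat S φ X}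

/-- The nonempty satisfying teams that are maximal with respect to inclusion. -/
def maxTeams {σ : Vocabulary} {A : Type} (φ : InclFormula σ) (S : Struct σ A) :
    Set (Set (Assignment A)) :=
  {X | IsTeam φ.free X ∧ Sat S φ X ∧ X.Nonempty ∧
    ∀ X', IsTeam φ.free X' → X ⊂ X' → ¬ Sat S φ X'}

/-- The nonempty satisfying teams of maximum cardinality. -/
def cardMaxTeams {σ : Vocabulary} {A : Type} (φ : InclFormula σ) (S : Struct σ A) :
    Set (Set (Assignment A)) :=
  {X | IsTeam φ.free X ∧ Sat S φ X ∧ X.Nonempty ∧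
    ∀ X', IsTeam φ.free X' → X.ncard < X'.ncard → ¬ Sat S φ X'}

/-! ### Encodings as binary words -/

/-- A finite structure, its universe being `{0, …, n - 1}`. -/
structure FinStruct (σ : Vocabulary) where
  n : ℕ
  str : Struct σ (Fin n)

open Classical in
/-- The characteristic word of a set of `k`-tuples over `{0, …, n - 1}`, of length `n ^ k`: the
tuple `t` has position `∑ i, t i * n ^ i`. -/
noncomputable def encTuples {n k : ℕ} (R : Set (Fin k → Fin n)) : List Bool :=
  List.ofFn fun p : Fin (n ^ k) => decide (finFunctionFinEquiv.symm p ∈ R)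

/-- A finite structure is coded by `1 ^ n 0` followed by the characteristic words of its
relations. -/
noncomputable def FinStruct.enc {σ : Vocabulary} (S : FinStruct σ) : List Bool :=
  List.replicate S.n true ++ [false] ++
    (List.ofFn fun i : Fin σ.numRel => encTuples (S.str.rel i)).flatten

/-- A team with domain `D` is coded by the characteristic word of the set of its value tuples,
the variables of `D` being taken in increasing order. -/
noncomputable def encTeam {n : ℕ} (D : Finset ℕ) (X : Set (Assignment (Fin n))) : List Bool :=
  encTuples {t : Fin D.card → Fin n | ∃ s ∈ X, ∀ j, s (D.orderEmbOfFin rfl j) = some (t j)}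

/-! ### Random access machines with an oracle -/

/-- Instructions of a random access machine with registers `R 0, R 1, …`, a read-only input word,
a write-only oracle query, and a write-only output. -/
inductive Instr : Type
  /-- `R i := c` -/
  | const (i c : ℕ)
  /-- `R i := R j + R k` -/
  | add (i j k : ℕ)
  /-- `R i := R j - R k`, truncated at `0` -/
  | sub (i j k : ℕ)
  /-- `R i := R (R j)` -/
  | load (i j : ℕ)
  /-- `R (R i) := R j` -/
  | store (i j : ℕ)
  /-- go to instruction `l` if `R i > 0` -/
  | jpos (i l : ℕ)
  /-- `R i :=` the input bit at position `R j` (as `0` or `1`), or `2` beyond the input -/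
  | read (i j : ℕ)
  /-- append a bit to the oracle query: `1` if `R i > 0`, and `0` otherwise -/
  | queryBit (i : ℕ)
  /-- ask the oracle: `R i := 1` if the query is in the oracle language, otherwise `R i := 0`;
  the query is then erased -/
  | ask (i : ℕ)
  /-- append a bit to the solution being written: `1` if `R i > 0`, and `0` otherwise -/
  | outBit (i : ℕ)
  /-- output the solution that has been written, and start a new one -/
  | output
  | halt

/-- A program: a finite list of instructions, numbered from `0`. -/
abbrev Program : Type := List Instr

/-- A configuration: program counter, registers, oracle query, and current solution. -/
structure Config where
  pc : ℕ
  reg : ℕ → ℕ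
  query : List Bool
  sol : List Bool

/-- The initial configuration. -/
def Config.init : Config where
  pc := 0
  reg := fun _ => 0
  query := []
  sol := []

/-- The current instruction; leaving the program means to halt. -/
def Program.fetch (M : Program) (c : Config) : Instr := (M[c.pc]?).getD Instr.halt

/-- The symbol read at position `i` of the input `x`. -/
def inputSymbol (x : List Bool) (i : ℕ) : ℕ :=
  match x[i]? with
  | none => 2
  | some false => 0
  | some true => 1

/-- Write `v` into register `i` and proceed to the next instruction. -/
def Config.write (c : Config) (i v : ℕ) : Config :=
  { c with pc := c.pc + 1, reg := Function.update c.reg i v }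

open Classical in
/-- The effect of an instruction, with oracle language `L` and input `x`. -/
noncomputable def Instr.exec (L : Set (List Bool)) (x : List Bool) (c : Config) : Instr → Config
  | .const i a => c.write i a
  | .add i j k => c.write i (c.reg j + c.reg k)
  | .sub i j k => c.write i (c.reg j - c.reg k)
  | .load i j => c.write i (c.reg (c.reg j))
  | .store i j => c.write (c.reg i) (c.reg j)
  | .jpos i l => { c with pc := if 0 < c.reg i then l else c.pc + 1 }
  | .read i j => c.write i (inputSymbol x (c.reg j))
  | .queryBit i => { c with pc := c.pc + 1, query := c.query ++ [decide (0 < c.reg i)] }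
  | .ask i => { c.write i (if c.query ∈ L then 1 else 0) with query := [] }
  | .outBit i => { c with pc := c.pc + 1, sol := c.sol ++ [decide (0 < c.reg i)] }
  | .output => { c with pc := c.pc + 1, sol := [] }
  | .halt => c

/-- The logarithmic cost of an instruction: one, plus the binary lengths of the numbers it
handles (an oracle call costs one step). -/
def Instr.cost (c : Config) : Instr → ℕ
  | .const _ a => 1 + a.size
  | .add _ j k => 1 + (c.reg j).size + (c.reg k).size
  | .sub _ j k => 1 + (c.reg j).size + (c.reg k).size
  | .load _ j => 1 + (c.reg j).size + (c.reg (c.reg j)).size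
  | .store i j => 1 + (c.reg i).size + (c.reg j).size
  | .jpos i _ => 1 + (c.reg i).size
  | .read _ j => 1 + (c.reg j).size
  | .queryBit i => 1 + (c.reg i).size
  | .ask _ => 1
  | .outBit i => 1 + (c.reg i).size
  | .output => 1
  | .halt => 1

/-- `Enumerates M L x d c t ws`: the program `M` with oracle `L` on input `x`, started in the
configuration `c` when time `t` has passed since the last output (or since the start), outputs
exactly the words of `ws`, in this order, and halts; every period up to the next output, from one
output to the next, and from the last output until halting takes time at most `d`, and all oracle
queries have length at most `d`. -/
inductive Enumerates (M : Program) (L : Set (List Bool)) (x : List Bool) (d : ℕ) :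
    Config → ℕ → List (List Bool) → Prop
  | halt (c : Config) (t : ℕ) (hc : M.fetch c = Instr.halt) (ht : t + 1 ≤ d) :
      Enumerates M L x d c t []
  | output (c : Config) (t : ℕ) (ws : List (List Bool)) (hc : M.fetch c = Instr.output)
      (ht : t + 1 ≤ d) (h : Enumerates M L x d (Instr.output.exec L x c) 0 ws) :
      Enumerates M L x d c t (c.sol :: ws)
  | step (c : Config) (t : ℕ) (ws : List (List Bool)) (hhalt : M.fetch c ≠ Instr.halt)
      (hout : M.fetch c ≠ Instr.output)
      (hask : ∀ i, M.fetch c = Instr.ask i → c.query.length ≤ d)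
      (h : Enumerates M L x d ((M.fetch c).exec L x c) (t + (M.fetch c).cost c) ws) :
      Enumerates M L x d c t ws

/-! ### Enumeration problems and the class of polynomial delay -/

/-- An enumeration problem: for each input word, the set of its solutions. -/
abbrev EnumProblem : Type := List Bool → Set (List Bool)

/-- The class `Del C`: problems enumerated, without repetition and with polynomial delay, by a
random access machine with an oracle in `C` and polynomially bounded queries. -/
def Del (C : Set (Set (List Bool))) : Set EnumProblem :=
  {E | ∃ L ∈ C, ∃ (M : Program) (p : Polynomial ℕ), ∀ x : List Bool,
    ∃ ws : List (List Bool), ws.Nodup ∧ {w | w ∈ ws} = E x ∧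
      Enumerates M L x (p.eval x.length) Config.init 0 ws}

open Classical in
/-- The class of languages over the binary alphabet decided by a Turing machine in polynomial
time. -/
def PTime : Set (Set (List Bool)) :=
  {L | Nonempty (Turing.TM2ComputableInPolyTime (fun x : List Bool => x)
    Computability.encodeBool (fun x => decide (x ∈ L)))}

/-- The class `DelP`. -/
def DelP : Set EnumProblem := Del PTime

/-- The function `f`, on inputs coded by `ea`, is computed in polynomial time by a random access
machine (whose oracle language is empty, so that the oracle is of no use). -/
def PolyTimeComputable {α : Type} (ea : α → List Bool) (f : α → List Bool) : Prop :=
  ∃ (M : Program) (p : Polynomial ℕ), ∀ a : α,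
    Enumerates M ∅ (ea a) (p.eval (ea a).length) Config.init 0 [f a]

/-- The problem to enumerate, for a given finite structure, all nonempty satisfying teams of `φ`
that are maximal with respect to inclusion. -/
def EMaxSat {σ : Vocabulary} (φ : InclFormula σ) : EnumProblem := fun x =>
  {w | ∃ S : FinStruct σ, x = S.enc ∧ ∃ X ∈ maxTeams φ S.str, w = encTeam φ.free X}

/-- The problem to enumerate, for a given finite structure, all nonempty satisfying teams of `φ`
of maximum cardinality. -/
def ECardMaxSat {σ : Vocabulary} (φ : InclFormula σ) : EnumProblem := fun x =>
  {w | ∃ S : FinStruct σ, x = S.enc ∧ ∃ X ∈ cardMaxTeams φ S.str, w = encTeam φ.free X}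

end TeamEnum

open TeamEnum

namespace TeamEnum

/-! Satisfaction in lax semantics is closed under arbitrary unions of teams (`sat_sUnion`). Hence
every team `X` has a greatest satisfying subteam, the union `best S φ X` of all of them. Taking the
full team for `X` gives the greatest satisfying team `T`. A nonempty satisfying team that is maximal
for inclusion, or for cardinality, must then be `T` (`maxTeams_eq`, `cardMaxTeams_eq`), so
enumeration amounts to computing one team and testing whether it is empty.

The operator `best` obeys recursion equations along the formula. Literals filter the team. A
disjunction gives the union of the two greatest subteams, because the halves may overlap
(`best_or`). An existential quantifier keeps the assignments with some extension in the greatest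
subteam of the duplicated team (`best_ex`). For conjunctions, inclusion atoms and universal
quantifiers one pass is not enough, since deleting assignments can destroy what the others rely on.
There `best` is reached by iterating a decreasing operator that never deletes a member of a
satisfying subteam and whose fixed points satisfy the formula (`best_iterate`). A team over `k`
variables has at most `n ^ k` members, so polynomially many rounds suffice; as `φ` is fixed, the
nesting of such iterations is bounded.

The rest realizes this recursion on the random access machine. `Impl` is a calculus of relocatable
code whose only loops run once per element of the universe; `ImplV` and `ImplA` lift it to
expressions and to transformers of arrays. Polynomially many steps have polynomial logarithmic cost,
because one step lengthens register contents by at most one bit (`enumerates_of_run`). A team is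
stored as an array indexed by positions of value tuples, and `computesBest` follows the recursion.
Words that code no structure are recognized by their length alone (`exists_enc_iff`). The oracle is
never consulted, so the empty language serves; total running time bounds every delay. -/

/-! ### The empty oracle -/

/-- A Turing machine that erases its input and rejects. -/
def rejectComputer : Turing.FinTM2 where
  K := Unit
  k₀ := ()
  k₁ := ()
  Γ _ := Bool
  Λ := Unit
  main := ()
  σ := Bool
  initialState := false
  Γk₀Fin := inferInstanceAs (Fintype Bool)
  m _ := .pop () (fun _ o => o.isNone)
    (.branch id (.push () (fun _ => false) (.load (fun _ => false) .halt)) (.goto fun _ => ()))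

/-- Each step pops one symbol; the pop that finds the stack empty pushes `false` and halts, whence
one step more than the length. The internal state is reset at the end because `Turing.haltList`
demands the initial one. -/
theorem rejectComputer_run (l : List Bool) :
    (flip bind rejectComputer.step)^[l.length + 1]
      (some (⟨some (), false, fun _ => l⟩ : Turing.TM2.Cfg (fun _ : Unit => Bool) Unit Bool)) =
    some (⟨none, false, fun _ => [false]⟩ : Turing.TM2.Cfg (fun _ : Unit => Bool) Unit Bool) := by
  induction l with
  | nil =>
    exact congrArg (fun S => some (⟨none, false, S⟩ :
      Turing.TM2.Cfg (fun _ : Unit => Bool) Unit Bool)) (funext fun k => rfl)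
  | cons b l ih =>
    rw [List.length_cons, Function.iterate_succ_apply, ← ih]
    exact congrArg (fun S => (flip bind rejectComputer.step)^[l.length + 1] (some ⟨some (), false, S⟩))
      (funext fun k => rfl)

theorem empty_mem_pTime : (∅ : Set (List Bool)) ∈ PTime := by
  refine ⟨⟨⟨rejectComputer, Equiv.refl _, Equiv.refl _⟩, Polynomial.X + 1, fun l => ?_⟩⟩
  refine ⟨⟨l.length + 1, ?_⟩, by simp⟩
  have hmap : List.map (Equiv.refl (rejectComputer.Γ rejectComputer.k₀)).invFun l = l :=
    List.map_id l
  have hdec : false = @decide (l ∈ (∅ : Set (List Bool))) (Classical.propDecidable _) := by simp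
  exact (congrArg (fun l' => (flip bind rejectComputer.step)^[l.length + 1]
    (some (Turing.initList rejectComputer l'))) hmap).trans
    ((rejectComputer_run l).trans
      (congrArg (fun b => some (Turing.haltList rejectComputer [b])) hdec))

/-! ### Running a program without oracle -/

/-- One step of the program `M` on input `x` with empty oracle, together with the list of outputs
written so far. -/
noncomputable def stepOut (M : Program) (x : List Bool) (p : Config × List (List Bool)) :
    Config × List (List Bool) :=
  ((M.fetch p.1).exec ∅ x p.1,
    match M.fetch p.1 with
    | .output => p.2 ++ [p.1.sol]
    | _ => p.2)

/-- All constants of the program have binary length at most `B`. -/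
def Program.ConstBound (M : Program) (B : ℕ) : Prop :=
  ∀ i a, Instr.const i a ∈ M → a.size ≤ B

theorem Program.exists_constBound (M : Program) : ∃ B, 2 ≤ B ∧ M.ConstBound B := by
  induction M with
  | nil => exact ⟨2, le_rfl, by simp [ConstBound]⟩
  | cons I M ih =>
    obtain ⟨B, hB, h⟩ := ih
    cases I
    case const i a =>
      refine ⟨max B a.size, le_max_of_le_left hB, fun j b hb => ?_⟩
      rcases List.mem_cons.1 hb with hb | hb
      · cases hb
        exact le_max_right _ _
      · exact (h _ _ hb).trans (le_max_left _ _)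
    all_goals
      refine ⟨B, hB, fun j b hb => ?_⟩
      rcases List.mem_cons.1 hb with hb | hb
      · cases hb
      · exact h _ _ hb

theorem Program.fetch_const {M : Program} {B : ℕ} (hM : M.ConstBound B) {c : Config} {i a : ℕ}
    (h : M.fetch c = .const i a) : a.size ≤ B := by
  unfold Program.fetch at h
  cases h' : M[c.pc]? with
  | none => simp [h'] at h
  | some I =>
    rw [h'] at h
    simp only [Option.getD_some] at h
    subst h
    exact hM i a (List.mem_of_getElem? h')

theorem Nat.size_add_le (a b B : ℕ) (ha : a.size ≤ B) (hb : b.size ≤ B) :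
    (a + b).size ≤ B + 1 := by
  rw [Nat.size_le] at *
  rw [pow_succ]
  omega

theorem size_inputSymbol_le (x : List Bool) (i : ℕ) : (inputSymbol x i).size ≤ 2 := by
  rw [Nat.size_le]
  unfold inputSymbol
  split <;> norm_num

/-- Addition is the only instruction that can outgrow the numbers already present, apart from
constants and input symbols, and it costs one more bit. This makes logarithmic cost polynomial in
the number of steps. -/
theorem size_reg_exec_le {M : Program} {B : ℕ} (hM : M.ConstBound B) {b : ℕ} (hb : 2 ≤ b)
    (hBb : B ≤ b) (x : List Bool) (c : Config) (hc : ∀ r, (c.reg r).size ≤ b) (r : ℕ) :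
    (((M.fetch c).exec ∅ x c).reg r).size ≤ b + 1 := by
  have key : ∀ i v, v.size ≤ b + 1 → ((c.write i v).reg r).size ≤ b + 1 := by
    intro i v hv
    simp only [Config.write, Function.update_apply]
    split
    · exact hv
    · exact (hc r).trans (Nat.le_succ _)
  have h0 := (hc r).trans (Nat.le_succ b)
  cases h : M.fetch c with
  | const i a => exact key _ _ (((M.fetch_const hM h).trans hBb).trans (Nat.le_succ _))
  | add i j k => exact key _ _ (Nat.size_add_le _ _ _ (hc _) (hc _))
  | sub i j k =>
    exact key _ _ ((Nat.size_le_size (Nat.sub_le _ _)).trans ((hc _).trans (Nat.le_succ _)))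
  | load i j => exact key _ _ ((hc _).trans (Nat.le_succ _))
  | store i j => exact key _ _ ((hc _).trans (Nat.le_succ _))
  | read i j => exact key _ _ ((size_inputSymbol_le _ _).trans (by omega))
  | ask i =>
    refine key _ _ ?_
    simp
  | jpos i l => exact h0
  | queryBit i => exact h0
  | outBit i => exact h0
  | output => exact h0
  | halt => exact h0

theorem cost_le {b : ℕ} (hb : 2 ≤ b) {M : Program} (hM : M.ConstBound b) (c : Config)
    (hc : ∀ r, (c.reg r).size ≤ b) : (M.fetch c).cost c ≤ 1 + 2 * b := by
  cases h : M.fetch c with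
  | const i a => have := M.fetch_const hM h; simp only [Instr.cost]; omega
  | add i j k => have := hc j; have := hc k; simp only [Instr.cost]; omega
  | sub i j k => have := hc j; have := hc k; simp only [Instr.cost]; omega
  | load i j => have := hc j; have := hc (c.reg j); simp only [Instr.cost]; omega
  | store i j => have := hc i; have := hc j; simp only [Instr.cost]; omega
  | jpos i l => have := hc i; simp only [Instr.cost]; omega
  | read i j => have := hc j; simp only [Instr.cost]; omega
  | queryBit i => have := hc i; simp only [Instr.cost]; omega
  | ask i => simp only [Instr.cost]; omega
  | outBit i => have := hc i; simp only [Instr.cost]; omega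
  | output => simp only [Instr.cost]; omega
  | halt => simp only [Instr.cost]; omega

/-- The program asks the oracle no questions. -/
def Program.NoQuery (M : Program) : Prop := ∀ i, Instr.queryBit i ∉ M

theorem Program.fetch_ne_queryBit {M : Program} (hM : M.NoQuery) (c : Config) (i : ℕ) :
    M.fetch c ≠ .queryBit i := by
  intro h
  unfold Program.fetch at h
  cases h' : M[c.pc]? with
  | none => simp [h'] at h
  | some I =>
    rw [h'] at h
    simp only [Option.getD_some] at h
    subst h
    exact hM i (List.mem_of_getElem? h')

theorem stepOut_of_halt {M : Program} {x : List Bool} {c : Config} (h : M.fetch c = .halt)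
    (o : List (List Bool)) (T : ℕ) : (stepOut M x)^[T] (c, o) = (c, o) := by
  have : stepOut M x (c, o) = (c, o) := by simp [stepOut, h, Instr.exec]
  exact Function.iterate_fixed this T

/-- During `T` steps all registers stay within `b + T` bits, so each step costs at most `1 + 2 * (b
+ T)`; the bound on the whole run is used for each single delay. A halting configuration is a fixed
point of `stepOut`, so `T` may exceed the actual number of steps. -/
theorem enumerates_of_run {M : Program} {B : ℕ} (hM : M.ConstBound B) (hq : M.NoQuery)
    {x : List Bool} {d : ℕ} (T : ℕ) :
    ∀ (b t : ℕ) (c : Config) (o ws : List (List Bool)) (c' : Config), 2 ≤ b → B ≤ b →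
      (∀ r, (c.reg r).size ≤ b) → c.query = [] →
      (stepOut M x)^[T] (c, o) = (c', o ++ ws) → M.fetch c' = .halt →
      t + T * (1 + 2 * (b + T)) + 1 ≤ d → Enumerates M ∅ x d c t ws := by
  induction T with
  | zero =>
    intro b t c o ws c' _ _ _ _ hrun hhalt hd
    simp only [Function.iterate_zero, id_eq, Prod.mk.injEq, List.self_eq_append_right] at hrun
    obtain ⟨rfl, rfl⟩ := hrun
    exact .halt _ _ hhalt (by omega)
  | succ T ih =>
    intro b t c o ws c' hb hBb hc hcq hrun hhalt hd
    by_cases hh : M.fetch c = .halt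
    · rw [stepOut_of_halt hh] at hrun
      simp only [Prod.mk.injEq, List.self_eq_append_right] at hrun
      obtain ⟨rfl, rfl⟩ := hrun
      exact .halt _ _ hhalt (by omega)
    have hcost := cost_le hb (fun i a h => (hM i a h).trans hBb) c hc
    have hreg := size_reg_exec_le hM hb hBb x c hc
    have hq' : ((M.fetch c).exec ∅ x c).query = [] := by
      cases h : M.fetch c with
      | queryBit i => exact absurd h (M.fetch_ne_queryBit hq c i)
      | _ => simp [Instr.exec, Config.write, hcq]
    have hd' : t + (M.fetch c).cost c + T * (1 + 2 * (b + 1 + T)) + 1 ≤ d := by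
      have : (T + 1) * (1 + 2 * (b + (T + 1))) =
        T * (1 + 2 * (b + 1 + T)) + (1 + 2 * (b + (T + 1))) := by ring
      omega
    rw [Function.iterate_succ_apply] at hrun
    by_cases ho : M.fetch c = .output
    · have hs : stepOut M x (c, o) = (Instr.output.exec ∅ x c, o ++ [c.sol]) := by
        simp [stepOut, ho]
      rw [hs] at hrun
      rw [ho] at hreg hq'
      -- Outputs are only ever appended, so the word written now must be the head of `ws`.
      have hpre : o ++ [c.sol] <+: o ++ ws := by
        have : ∀ (T : ℕ) (p : Config × List (List Bool)), p.2 <+: ((stepOut M x)^[T] p).2 := by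
          intro T
          induction T with
          | zero => intro p; exact List.prefix_rfl
          | succ T ih =>
            intro p
            rw [Function.iterate_succ_apply']
            refine (ih p).trans ?_
            simp only [stepOut]
            split
            · exact List.prefix_append _ _
            · exact List.prefix_rfl
        have := this T (Instr.output.exec ∅ x c, o ++ [c.sol])
        rwa [hrun] at this
      obtain ⟨ws', hws⟩ := hpre
      have hws' : ws = c.sol :: ws' := by
        have : o ++ ([c.sol] ++ ws') = o ++ ws := by rw [← hws, List.append_assoc]
        simpa using (List.append_cancel_left this).symm
      subst hws'
      refine .output _ _ _ ho (by omega) ?_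
      refine ih (b + 1) 0 _ (o ++ [c.sol]) ws' c' (by omega) (by omega) hreg hq' ?_ hhalt
        (by omega)
      rw [hrun]
      simp
    · have hs : stepOut M x (c, o) = ((M.fetch c).exec ∅ x c, o) := by
        simp only [stepOut]
      rw [hs] at hrun
      refine .step _ _ _ hh ho (fun i _ => by simp [hcq]) ?_
      exact ih (b + 1) _ _ o ws c' (by omega) (by omega) hreg hq' hrun hhalt hd'

/-! ### Structured programs -/

/-- The names of scalar registers: `Sum.inl y` holds the value of the first-order variable `y`,
and `Sum.inr j` is a work register. -/
abbrev Reg : Type := ℕ ⊕ ℕ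

/-- The machine register of a scalar. -/
def phys : Reg → ℕ
  | .inl y => 4 * y + 5
  | .inr j => 4 * j + 7

/-- The machine register of the entry `a` of the array `q`. -/
def cell (q a : ℕ) : ℕ := 2 ^ (q + 1) * (2 * a + 1)

theorem phys_injective : Function.Injective phys := by
  rintro (x | x) (y | y) h <;> simp only [phys] at h
  · congr 1; omega
  · omega
  · omega
  · congr 1; omega

theorem phys_inj {r r' : Reg} : phys r = phys r' ↔ r = r' := phys_injective.eq_iff

/-- The memory layout: register `0` is scratch for addresses, `1` and `3` hold the constants of
`Represents`, scalars take the odd registers from `5` on, and array entries the positive even ones.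
-/
theorem phys_ne (r : Reg) : phys r ≠ 0 ∧ phys r ≠ 1 ∧ phys r ≠ 3 := by
  rcases r with x | x <;> simp only [phys] <;> omega

theorem cell_eq_two_mul (q a : ℕ) : cell q a = 2 * (2 ^ q * (2 * a + 1)) := by
  rw [cell, pow_succ]
  ring

theorem cell_ne_phys (q a : ℕ) (r : Reg) : cell q a ≠ phys r := by
  rw [cell_eq_two_mul]
  rcases r with x | x <;> simp only [phys] <;> omega

theorem cell_ne (q a : ℕ) : cell q a ≠ 0 ∧ cell q a ≠ 1 ∧ cell q a ≠ 3 := by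
  have : 0 < 2 ^ q * (2 * a + 1) := by positivity
  rw [cell_eq_two_mul]
  omega

/-- The exponent of two in an address determines the array and the odd part determines the index. -/
theorem cell_inj {q a q' a' : ℕ} : cell q a = cell q' a' ↔ q = q' ∧ a = a' := by
  refine ⟨fun h => ?_, by rintro ⟨rfl, rfl⟩; rfl⟩
  induction q generalizing q' with
  | zero =>
    cases q' with
    | zero => exact ⟨rfl, by simp only [cell] at h; omega⟩
    | succ q' =>
      simp only [cell, pow_succ] at h
      have : 2 ^ q' * 2 * 2 * (2 * a' + 1) = 4 * (2 ^ q' * (2 * a' + 1)) := by ring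
      omega
  | succ q ih =>
    cases q' with
    | zero =>
      simp only [cell, pow_succ] at h
      have : 2 ^ q * 2 * 2 * (2 * a + 1) = 4 * (2 ^ q * (2 * a + 1)) := by ring
      omega
    | succ q' =>
      obtain ⟨h1, h2⟩ := @ih q' (by
        simp only [cell, pow_succ] at h ⊢
        have h1 : 2 ^ q * 2 * 2 * (2 * a + 1) = 2 * (2 ^ q * 2 * (2 * a + 1)) := by ring
        have h2 : 2 ^ q' * 2 * 2 * (2 * a' + 1) = 2 * (2 ^ q' * 2 * (2 * a' + 1)) := by ring
        omega)
      exact ⟨by rw [h1], h2⟩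

/-! ### States, their representation by configurations, and relocatable code -/

/-- The size of the universe, as announced by a word: its number of leading ones. -/
def univSize (x : List Bool) : ℕ := (x.takeWhile id).length

theorem univSize_le (x : List Bool) : univSize x ≤ x.length := (List.takeWhile_prefix _).length_le

/-- The arrays in memory, the solution being written, and the outputs so far. -/
structure Data where
  arr : ℕ → ℕ → ℕ
  sol : List Bool
  outs : List (List Bool)

/-- The state of a structured program. -/
structure MState where
  v : Reg → ℕ
  data : Data

/-- Change a scalar. -/
def MState.set (s : MState) (r : Reg) (a : ℕ) : MState :=
  { s with v := Function.update s.v r a }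

/-- The values of the first-order variables. -/
def MState.env (s : MState) : ℕ → ℕ := fun y => s.v (.inl y)

/-- Change an entry of an array. -/
def Data.setArr (D : Data) (q a b : ℕ) : Data :=
  { D with arr := Function.update D.arr q (Function.update (D.arr q) a b) }

/-- A machine configuration represents a state. Register `1` holds the number `1` and register
`3` holds the size of the universe. -/
structure Represents (x : List Bool) (s : MState) (c : Config) : Prop where
  one : c.reg 1 = 1
  size : c.reg 3 = univSize x
  scalar : ∀ r, c.reg (phys r) = s.v r
  array : ∀ q a, c.reg (cell q a) = s.data.arr q a
  sol : c.sol = s.data.sol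
  query : c.query = []

/-- The code, placed after `pre` and before `post`, transforms states by `f` in at most `B`
steps. -/
def Realizes (pre code post : Program) (x : List Bool) (f : MState → MState) (B : ℕ) : Prop :=
  ∀ s c, c.pc = pre.length → Represents x s c →
    ∃ T ≤ B, ∃ c', c'.pc = pre.length + code.length ∧ Represents x (f s) c' ∧
      (stepOut (pre ++ code ++ post) x)^[T] (c, s.data.outs) = (c', (f s).data.outs)

/-- A state transformer, depending on the input, that is implemented by a program with a
polynomial number of steps. -/
def Impl (f : List Bool → MState → MState) : Prop :=
  ∃ (p : Polynomial ℕ) (len : ℕ) (code : ℕ → Program),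
    (∀ a, (code a).length = len ∧ (code a).NoQuery) ∧
    ∀ pre post x, Realizes pre (code pre.length) post x (f x) (p.eval x.length)

theorem NoQuery.append {M N : Program} (hM : M.NoQuery) (hN : N.NoQuery) :
    Program.NoQuery (M ++ N) := fun i h => (List.mem_append.1 h).elim (hM i) (hN i)

theorem Realizes.comp {pre code₁ code₂ post : Program} {x : List Bool} {f g : MState → MState}
    {B C : ℕ} (hf : Realizes pre code₁ (code₂ ++ post) x f B)
    (hg : Realizes (pre ++ code₁) code₂ post x g C) :
    Realizes pre (code₁ ++ code₂) post x (g ∘ f) (B + C) := by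
  intro s c hc hs
  obtain ⟨T, hT, c', hc', hs', hrun⟩ := hf s c hc hs
  obtain ⟨U, hU, c'', hc'', hs'', hrun'⟩ := hg (f s) c' (by simpa using hc') hs'
  refine ⟨U + T, by omega, c'', by simpa [add_assoc] using hc'', hs'', ?_⟩
  rw [Function.iterate_add_apply]
  simp only [← List.append_assoc] at hrun hrun' ⊢
  rw [hrun, hrun']
  rfl

/-- Jump targets are absolute, so code is a function of its starting position; as its length does
not depend on that position, the second block knows where it begins. -/
theorem Impl.comp {f g : List Bool → MState → MState} (hg : Impl g) (hf : Impl f) :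
    Impl fun x s => g x (f x s) := by
  obtain ⟨p, l, code, hl, h⟩ := hf
  obtain ⟨p', l', code', hl', h'⟩ := hg
  refine ⟨p + p', l + l', fun a => code a ++ code' (a + l), fun a => ⟨?_, ?_⟩, ?_⟩
  · simp [(hl _).1, (hl' _).1]
  · exact NoQuery.append (hl _).2 (hl' _).2
  · intro pre post x
    rw [Polynomial.eval_add]
    refine Realizes.comp (h _ _ _) ?_
    have := h' (pre ++ code pre.length) post x
    rwa [List.length_append, (hl _).1] at this

theorem Impl.id : Impl fun _ s => s :=
  ⟨0, 0, fun _ => [], fun _ => ⟨rfl, by simp [Program.NoQuery]⟩,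
    fun pre post x s c hc hs => ⟨0, by simp, c, by simpa using hc, hs, rfl⟩⟩

/-- The instruction at the current position. -/
theorem fetch_append {pre post : Program} {I : Instr} {c : Config} (hc : c.pc = pre.length) :
    Program.fetch (pre ++ I :: post) c = I := by
  simp [Program.fetch, hc]

/-! ### Straight-line code -/

/-- Instructions that neither jump nor output nor use the oracle. -/
def Instr.Linear : Instr → Prop
  | .const _ _ | .add _ _ _ | .sub _ _ _ | .load _ _ | .store _ _ | .read _ _ | .outBit _ => True
  | _ => False

/-- The effect of a list of instructions. -/
noncomputable def execList (x : List Bool) (l : Program) (c : Config) : Config :=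
  l.foldl (fun c I => I.exec ∅ x c) c

theorem run_linear (x : List Bool) (l : Program) (hl : ∀ I ∈ l, I.Linear) :
    ∀ (pre post : Program) (c : Config) (o : List (List Bool)), c.pc = pre.length →
      (stepOut (pre ++ l ++ post) x)^[l.length] (c, o) = (execList x l c, o) ∧
      (execList x l c).pc = pre.length + l.length := by
  induction l with
  | nil => intro pre post c o hc; exact ⟨rfl, hc⟩
  | cons I l ih =>
    intro pre post c o hc
    have hI := hl I (by simp)
    have hpc : (I.exec ∅ x c).pc = (pre ++ [I]).length := by
      cases I <;> simp_all [Instr.Linear, Instr.exec, Config.write]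
    obtain ⟨h1, h2⟩ := ih (fun J hJ => hl J (by simp [hJ])) (pre ++ [I]) post (I.exec ∅ x c) o hpc
    have hf : Program.fetch (pre ++ I :: l ++ post) c = I := by
      rw [List.append_assoc, List.cons_append]
      exact fetch_append hc
    have hs : stepOut (pre ++ I :: l ++ post) x (c, o) = (I.exec ∅ x c, o) := by
      simp only [stepOut, hf]
      cases I <;> simp_all [Instr.Linear]
    have he : execList x (I :: l) c = execList x l (I.exec ∅ x c) := rfl
    rw [he]
    refine ⟨?_, ?_⟩
    · rw [List.length_cons, Function.iterate_succ_apply, hs]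
      simpa using h1
    · rw [List.length_cons]
      simpa [add_assoc, add_comm 1] using h2

theorem Impl.of_linear {f : List Bool → MState → MState} (l : Program)
    (hl : ∀ I ∈ l, I.Linear)
    (h : ∀ x s c, Represents x s c → Represents x (f x s) (execList x l c))
    (ho : ∀ x s, (f x s).data.outs = s.data.outs) : Impl f := by
  refine ⟨Polynomial.C l.length, l.length, fun _ => l, fun _ => ⟨rfl, fun i hi => hl _ hi⟩, ?_⟩
  intro pre post x s c hc hs
  obtain ⟨h1, h2⟩ := run_linear x l hl pre post c s.data.outs hc
  exact ⟨l.length, by simp, _, h2, h x s c hs, by rw [h1, ho]⟩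

theorem Represents.write_scalar {x : List Bool} {s : MState} {c : Config} (h : Represents x s c)
    (r : Reg) (a : ℕ) : Represents x (s.set r a) (c.write (phys r) a) where
  one := (Function.update_of_ne (phys_ne r).2.1.symm _ _).trans h.one
  size := (Function.update_of_ne (phys_ne r).2.2.symm _ _).trans h.size
  scalar r' := by
    simp only [Config.write, MState.set, Function.update_apply, phys_inj, h.scalar]
  array q b := (Function.update_of_ne (cell_ne_phys q b r) _ _).trans (h.array q b)
  sol := h.sol
  query := h.query

theorem Represents.write_cell {x : List Bool} {s : MState} {c : Config} (h : Represents x s c)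
    (q a b : ℕ) :
    Represents x { s with data := s.data.setArr q a b } (c.write (cell q a) b) where
  one := (Function.update_of_ne (cell_ne q a).2.1.symm _ _).trans h.one
  size := (Function.update_of_ne (cell_ne q a).2.2.symm _ _).trans h.size
  scalar r := by
    rw [← h.scalar]
    exact Function.update_of_ne (cell_ne_phys q a r).symm _ _
  array q' a' := by
    simp only [Config.write, Data.setArr, Function.update_apply, cell_inj, h.array]
    by_cases hq : q' = q
    · subst hq
      simp [Function.update_apply]
    · simp [hq]
  sol := h.sol
  query := h.query

theorem Represents.write_zero {x : List Bool} {s : MState} {c : Config} (h : Represents x s c)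
    (a : ℕ) : Represents x s (c.write 0 a) where
  one := h.one
  size := h.size
  scalar r := by
    rw [← h.scalar]
    exact Function.update_of_ne (phys_ne r).1 _ _
  array q b := by
    rw [← h.array]
    exact Function.update_of_ne (cell_ne q b).1 _ _
  sol := h.sol
  query := h.query

theorem Impl.const (r : Reg) (a : ℕ) : Impl fun _ s => s.set r a :=
  .of_linear [.const (phys r) a] (by simp [Instr.Linear])
    (fun _ _ _ h => h.write_scalar r a) fun _ _ => rfl

theorem Impl.add (r i j : Reg) : Impl fun _ s => s.set r (s.v i + s.v j) :=
  .of_linear [.add (phys r) (phys i) (phys j)] (by simp [Instr.Linear])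
    (fun _ _ _ h => by
      rw [← h.scalar i, ← h.scalar j]
      exact h.write_scalar r _) fun _ _ => rfl

theorem Impl.sub (r i j : Reg) : Impl fun _ s => s.set r (s.v i - s.v j) :=
  .of_linear [.sub (phys r) (phys i) (phys j)] (by simp [Instr.Linear])
    (fun _ _ _ h => by
      rw [← h.scalar i, ← h.scalar j]
      exact h.write_scalar r _) fun _ _ => rfl

theorem Impl.inp (r i : Reg) : Impl fun x s => s.set r (inputSymbol x (s.v i)) :=
  .of_linear [.read (phys r) (phys i)] (by simp [Instr.Linear])
    (fun _ _ _ h => by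
      rw [← h.scalar i]
      exact h.write_scalar r _) fun _ _ => rfl

theorem Impl.move (r i : Reg) : Impl fun _ s => s.set r (s.v i) :=
  .of_linear [.const 0 0, .add (phys r) 0 (phys i)] (by simp [Instr.Linear])
    (fun x s c h => by
      have h' := (h.write_zero 0).write_scalar r (s.v i)
      have : s.v i = (c.write 0 0).reg 0 + (c.write 0 0).reg (phys i) := by
        simp [Config.write, (phys_ne i).1, h.scalar]
      rw [this] at h' ⊢
      exact h') fun _ _ => rfl

/-- Code that computes into register `0` the address of an array entry. -/
def addrCode (q : ℕ) (i : Reg) : Program :=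
  [.add 0 (phys i) (phys i), .add 0 0 1] ++ List.replicate (q + 1) (.add 0 0 0)

theorem addrCode_linear (q : ℕ) (i : Reg) : ∀ I ∈ addrCode q i, I.Linear := by
  intro I hI
  simp only [addrCode, List.cons_append, List.nil_append, List.mem_cons, List.mem_replicate] at hI
  rcases hI with rfl | rfl | ⟨_, rfl⟩ <;> trivial

/-- The machine cannot multiply, but the index `a` becomes `2 * a + 1` by two additions, and `q + 1`
doublings supply the power of two. -/
theorem execList_addrCode {x : List Bool} {s : MState} {c : Config} (h : Represents x s c)
    (q : ℕ) (i : Reg) : Represents x s (execList x (addrCode q i) c) ∧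
      (execList x (addrCode q i) c).reg 0 = cell q (s.v i) := by
  have key : ∀ (m : ℕ) (c : Config), Represents x s c →
      Represents x s (execList x (List.replicate m (.add 0 0 0)) c) ∧
        (execList x (List.replicate m (.add 0 0 0)) c).reg 0 = 2 ^ m * c.reg 0 := by
    intro m
    induction m with
    | zero => intro c h; exact ⟨h, by simp [execList]⟩
    | succ m ih =>
      intro c h
      obtain ⟨h1, h2⟩ := ih (c.write 0 (c.reg 0 + c.reg 0)) (h.write_zero _)
      refine ⟨h1, ?_⟩
      have : (execList x (List.replicate (m + 1) (.add 0 0 0)) c).reg 0 =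
        2 ^ m * (c.write 0 (c.reg 0 + c.reg 0)).reg 0 := h2
      rw [this]
      simp only [Config.write, Function.update_self]
      ring
  obtain ⟨h1, h2⟩ := key (q + 1) ((c.write 0 (c.reg (phys i) + c.reg (phys i))).write 0
    (c.reg (phys i) + c.reg (phys i) + 1)) ((h.write_zero _).write_zero _)
  have he : execList x (addrCode q i) c = execList x (List.replicate (q + 1) (.add 0 0 0))
      ((c.write 0 (c.reg (phys i) + c.reg (phys i))).write 0
        (c.reg (phys i) + c.reg (phys i) + 1)) := by
    simp [addrCode, execList, Instr.exec, Config.write, h.one]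
  rw [he]
  refine ⟨h1, ?_⟩
  rw [h2, cell, ← h.scalar]
  simp only [Config.write, Function.update_self]
  ring

theorem Impl.load (r : Reg) (q : ℕ) (i : Reg) :
    Impl fun _ s => s.set r (s.data.arr q (s.v i)) := by
  refine .of_linear (addrCode q i ++ [.load (phys r) 0]) ?_ ?_ fun _ _ => rfl
  · intro I hI
    rcases List.mem_append.1 hI with hI | hI
    · exact addrCode_linear q i I hI
    · simp only [List.mem_singleton] at hI
      subst hI
      trivial
  · intro x s c h
    obtain ⟨h1, h2⟩ := execList_addrCode h q i
    have h3 := h1.write_scalar r (s.data.arr q (s.v i))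
    rw [← h1.array, ← h2] at h3
    rw [← h1.array, ← h2]
    simpa [execList, Instr.exec] using h3

theorem Impl.store (q : ℕ) (i j : Reg) :
    Impl fun _ s => { s with data := s.data.setArr q (s.v i) (s.v j) } := by
  refine .of_linear (addrCode q i ++ [.store 0 (phys j)]) ?_ ?_ fun _ _ => rfl
  · intro I hI
    rcases List.mem_append.1 hI with hI | hI
    · exact addrCode_linear q i I hI
    · simp only [List.mem_singleton] at hI
      subst hI
      trivial
  · intro x s c h
    obtain ⟨h1, h2⟩ := execList_addrCode h q i
    have h3 := h1.write_cell q (s.v i) (s.v j)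
    rw [← h1.scalar j, ← h2] at h3
    rw [← h1.scalar j]
    simpa [execList, Instr.exec] using h3

theorem Impl.outBit (r : Reg) :
    Impl fun _ s => { s with data := { s.data with sol := s.data.sol ++ [decide (0 < s.v r)] } } :=
  .of_linear [.outBit (phys r)] (by simp [Instr.Linear])
    (fun _ s c h => by
      refine ⟨h.one, h.size, h.scalar, h.array, ?_, h.query⟩
      simp [execList, Instr.exec, h.sol, h.scalar]) fun _ _ => rfl

theorem Impl.output :
    Impl fun _ s => { s with data := ⟨s.data.arr, [], s.data.outs ++ [s.data.sol]⟩ } := by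
  refine ⟨1, 1, fun _ => [.output], fun _ => ⟨rfl, by simp [Program.NoQuery]⟩, ?_⟩
  intro pre post x s c hc hs
  have hf : Program.fetch (pre ++ [.output] ++ post) c = .output := by
    rw [List.append_assoc]
    exact fetch_append hc
  refine ⟨1, by simp, { c with pc := c.pc + 1, sol := [] }, by simp [hc],
    ⟨hs.one, hs.size, hs.scalar, hs.array, rfl, hs.query⟩, ?_⟩
  rw [Function.iterate_one]
  simp only [stepOut, hf, Instr.exec, ← hs.sol]

/-! ### Branching and bounded loops -/

theorem Represents.jump {x : List Bool} {s : MState} {c : Config} (h : Represents x s c) (l : ℕ) :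
    Represents x s { c with pc := l } := ⟨h.one, h.size, h.scalar, h.array, h.sol, h.query⟩

theorem stepOut_jpos {M pre post : Program} {i l : ℕ} (hM : M = pre ++ .jpos i l :: post)
    (x : List Bool) {c : Config} (hc : c.pc = pre.length) (o : List (List Bool)) :
    stepOut M x (c, o) = ({ c with pc := if 0 < c.reg i then l else c.pc + 1 }, o) := by
  have hf : Program.fetch M c = .jpos i l := by
    rw [hM]
    exact fetch_append hc
  simp [stepOut, hf, Instr.exec]

theorem Impl.ite (r : Reg) {f g : List Bool → MState → MState} (hf : Impl f) (hg : Impl g) :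
    Impl fun x s => if 0 < s.v r then f x s else g x s := by
  obtain ⟨p, l, code, hl, h⟩ := hf
  obtain ⟨p', l', code', hl', h'⟩ := hg
  -- Layout: conditional jump to the positive branch, the other branch, a jump past the end, the
  -- positive branch. Since register `1` holds one, `jpos 1` is unconditional.
  refine ⟨p + p' + Polynomial.C 2, l' + l + 2,
    fun a => [.jpos (phys r) (a + l' + 2)] ++ code' (a + 1) ++ [.jpos 1 (a + l' + l + 2)] ++
      code (a + l' + 2), fun a => ⟨?_, ?_⟩, ?_⟩
  · simp [(hl _).1, (hl' _).1]; omega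
  · refine NoQuery.append (NoQuery.append (NoQuery.append ?_ (hl' _).2) ?_) (hl _).2 <;>
      simp [Program.NoQuery]
  intro pre post x s c hc hs
  set a := pre.length with ha
  set J := Instr.jpos (phys r) (a + l' + 2)
  set K := Instr.jpos 1 (a + l' + l + 2)
  set M := pre ++ ([J] ++ code' (a + 1) ++ [K] ++ code (a + l' + 2)) ++ post with hM
  have hstep := stepOut_jpos (M := M) (pre := pre) (i := phys r) (l := a + l' + 2)
    (post := code' (a + 1) ++ [K] ++ code (a + l' + 2) ++ post) (by simp [hM, J]) x hc s.data.outs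
  rw [hs.scalar] at hstep
  simp only [Polynomial.eval_add, Polynomial.eval_C]
  by_cases hr : 0 < s.v r
  · rw [if_pos hr]
    rw [if_pos hr] at hstep
    have hlen : (pre ++ [J] ++ code' (a + 1) ++ [K]).length = a + l' + 2 := by
      simp [(hl' _).1, ← ha]; omega
    have hR := h (pre ++ [J] ++ code' (a + 1) ++ [K]) post x
    rw [hlen] at hR
    obtain ⟨T, hT, c', hc', hs', hrun⟩ := hR s { c with pc := a + l' + 2 } hlen.symm (hs.jump _)
    refine ⟨T + 1, by omega, c', ?_, hs', ?_⟩
    · rw [hc', hlen]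
      simp [(hl _).1, (hl' _).1]; omega
    · rw [Function.iterate_succ_apply, hstep, ← hrun]
      simp [hM]
  · rw [if_neg hr]
    rw [if_neg hr] at hstep
    have hlen : (pre ++ [J]).length = a + 1 := by simp [← ha]
    have hR := h' (pre ++ [J]) ([K] ++ code (a + l' + 2) ++ post) x
    rw [hlen] at hR
    obtain ⟨T, hT, c', hc', hs', hrun⟩ := hR s { c with pc := c.pc + 1 } (by simp [hc, ← ha])
      (hs.jump _)
    rw [hlen, (hl' _).1] at hc'
    have hstep' := stepOut_jpos (M := M) (pre := pre ++ [J] ++ code' (a + 1)) (i := 1)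
      (l := a + l' + l + 2) (post := code (a + l' + 2) ++ post) (by simp [hM, K]) x
      (c := c') (by simp [hc', (hl' _).1, ← ha]; omega) (g x s).data.outs
    rw [hs'.one, if_pos one_pos] at hstep'
    refine ⟨1 + (T + 1), by omega, { c' with pc := a + l' + l + 2 }, ?_, hs'.jump _, ?_⟩
    · simp [(hl _).1, (hl' _).1]; omega
    · have hrun' : (stepOut M x)^[T] ({ c with pc := c.pc + 1 }, s.data.outs) =
          (c', (g x s).data.outs) := by
        rw [← hrun]
        simp [hM]
      rw [Function.iterate_add_apply, Function.iterate_succ_apply _ T, hstep, hrun',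
        Function.iterate_one, hstep']

/-- Repeat `f` as often as the universe has elements, with the work register `j` as counter. -/
def repeatSize (j : ℕ) (f : List Bool → MState → MState) (x : List Bool) (s : MState) : MState :=
  (fun s => (f x s).set (.inr j) ((f x s).v (.inr j) - 1))^[univSize x]
    (s.set (.inr j) (univSize x))

theorem Impl.repeatSize (j : ℕ) {f : List Bool → MState → MState} (hf : Impl f)
    (hj : ∀ x s, (f x s).v (.inr j) = s.v (.inr j)) : Impl (repeatSize j f) := by
  obtain ⟨p, l, code, hl, h⟩ := hf
  let A : Program := [.const 0 0, .add (phys (.inr j)) 0 3]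
  let J : ℕ → Instr := fun b => .jpos (phys (.inr j)) (b + 2)
  let K : ℕ → Instr := fun b => .jpos 1 (b + l + 4)
  let D : Instr := .sub (phys (.inr j)) (phys (.inr j)) 1
  let loop : ℕ → Program := fun b => [J b, K b] ++ code (b + 2) ++ [D, .jpos 1 b]
  -- A round adds three steps to the body: test, decrement, jump back. The four others are the two
  -- that set the counter and the final test with the exit jump at `K`.
  refine ⟨Polynomial.X * (p + Polynomial.C 3) + Polynomial.C 4, l + 6,
    fun a => A ++ loop (a + 2), fun a => ⟨?_, ?_⟩, ?_⟩
  · simp [A, loop, (hl _).1]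
  · refine NoQuery.append (by simp [Program.NoQuery, A]) (NoQuery.append (NoQuery.append ?_
      (hl _).2) ?_) <;> simp [Program.NoQuery, J, K, D]
  intro pre post x s c hc hs
  obtain ⟨b, hb⟩ : ∃ b, b = pre.length + 2 := ⟨_, rfl⟩
  have hbA : (pre ++ A).length = b := by simp [A, hb]
  let M : Program := pre ++ (A ++ loop b) ++ post
  have hloop : ∀ (m : ℕ) (s : MState) (c : Config), s.v (.inr j) = m → c.pc = b →
      Represents x s c → ∃ T ≤ m * (p.eval x.length + 3) + 2, ∃ c', c'.pc = b + l + 4 ∧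
        Represents x
          ((fun s => (f x s).set (.inr j) ((f x s).v (.inr j) - 1))^[m] s) c' ∧
        (stepOut M x)^[T] (c, s.data.outs) =
          (c', ((fun s => (f x s).set (.inr j) ((f x s).v (.inr j) - 1))^[m] s).data.outs) := by
    intro m
    induction m with
    | zero =>
      intro s c hsm hc hs
      have h1 := stepOut_jpos (M := M) (pre := pre ++ A) (i := phys (.inr j)) (l := b + 2)
        (post := [K b] ++ code (b + 2) ++ [D, .jpos 1 b] ++ post) (by simp [M, loop, J]) x
        (hc.trans hbA.symm) s.data.outs
      have h2 := stepOut_jpos (M := M) (pre := pre ++ A ++ [J b]) (i := 1) (l := b + l + 4)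
        (post := code (b + 2) ++ [D, .jpos 1 b] ++ post) (by simp [M, loop, K]) x
        (c := { c with pc := c.pc + 1 }) (by simp [hc, ← hbA, add_assoc]) s.data.outs
      rw [hs.scalar, hsm, if_neg (lt_irrefl 0)] at h1
      simp only [hs.one, if_pos one_pos] at h2
      refine ⟨2, by omega, { c with pc := b + l + 4 }, rfl, hs.jump _, ?_⟩
      rw [Function.iterate_succ_apply, h1, Function.iterate_one, h2]
      rfl
    | succ m ih =>
      intro s c hsm hc hs
      have h1 := stepOut_jpos (M := M) (pre := pre ++ A) (i := phys (.inr j)) (l := b + 2)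
        (post := [K b] ++ code (b + 2) ++ [D, .jpos 1 b] ++ post) (by simp [M, loop, J]) x
        (hc.trans hbA.symm) s.data.outs
      rw [hs.scalar, hsm, if_pos (Nat.succ_pos m)] at h1
      have hlen : (pre ++ A ++ [J b, K b]).length = b + 2 := by simp [← hbA, add_assoc]
      have hR := h (pre ++ A ++ [J b, K b]) ([D, .jpos 1 b] ++ post) x
      rw [hlen] at hR
      obtain ⟨T, hT, c', hc', hs', hrun⟩ := hR s { c with pc := b + 2 } hlen.symm (hs.jump _)
      rw [hlen, (hl _).1] at hc'
      have hD := run_linear x [D] (by simp [D, Instr.Linear])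
        (pre ++ A ++ [J b, K b] ++ code (b + 2)) ([.jpos 1 b] ++ post) c' (f x s).data.outs
        (by rw [hc', List.length_append, hlen, (hl _).1])
      set c'' := execList x [D] c' with hc''
      have hs'' : Represents x ((f x s).set (.inr j) ((f x s).v (.inr j) - 1)) c'' := by
        have := hs'.write_scalar (.inr j) ((f x s).v (.inr j) - 1)
        rw [hc'']
        simpa [execList, D, Instr.exec, hs'.scalar, hs'.one] using this
      have hj' : stepOut M x (c'', (f x s).data.outs) =
          ({ c'' with pc := b }, (f x s).data.outs) := by
        have := stepOut_jpos (M := M) (pre := pre ++ A ++ [J b, K b] ++ code (b + 2) ++ [D])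
          (i := 1) (l := b) (post := post) (by simp [M, loop]) x (c := c'')
          (by rw [hD.2, ← List.length_append]) (f x s).data.outs
        rw [this, hs''.one, if_pos one_pos]
      obtain ⟨U, hU, e, he, hse, hrune⟩ := ih ((f x s).set (.inr j) ((f x s).v (.inr j) - 1))
        { c'' with pc := b } (by simp [MState.set, hj, hsm]) rfl (hs''.jump _)
      refine ⟨U + (1 + (1 + (T + 1))), ?_, e, he, ?_, ?_⟩
      · have : (m + 1) * (p.eval x.length + 3) =
          m * (p.eval x.length + 3) + (p.eval x.length + 3) := by ring
        omega
      · rwa [Function.iterate_succ_apply]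
      · have hrun' : (stepOut M x)^[T] ({ c with pc := b + 2 }, s.data.outs) =
            (c', (f x s).data.outs) := by
          rw [← hrun]
          simp [M, loop]
        have hD' : stepOut M x (c', (f x s).data.outs) = (c'', (f x s).data.outs) := by
          rw [← hD.1]
          simp [M, loop]
        rw [Function.iterate_add_apply, Function.iterate_add_apply, Function.iterate_add_apply,
          Function.iterate_succ_apply _ T, h1, hrun', Function.iterate_one, hD', hj',
          Function.iterate_succ_apply _ m]
        exact hrune
  have hA := run_linear x A (by simp [A, Instr.Linear]) pre (loop b ++ post) c s.data.outs hc
  have hsA : Represents x (s.set (.inr j) (univSize x)) (execList x A c) := by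
    have h' := (hs.write_zero 0).write_scalar (.inr j) (univSize x)
    have : univSize x = (c.write 0 0).reg 0 + (c.write 0 0).reg 3 := by
      simp [Config.write, hs.size]
    rw [this] at h' ⊢
    exact h'
  obtain ⟨T, hT, c', hc', hs', hrun⟩ := hloop (univSize x) _ _ (by simp [MState.set])
    (by rw [hA.2, hb]; rfl) hsA
  refine ⟨T + 2, ?_, c', ?_, hs', ?_⟩
  · have := Nat.mul_le_mul_right (p.eval x.length + 3) (univSize_le x)
    simp only [Polynomial.eval_add, Polynomial.eval_mul, Polynomial.eval_X, Polynomial.eval_C]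
    omega
  · rw [hc', hb]
    simp [A, loop, (hl _).1]; omega
  · have hA' : (stepOut M x)^[2] (c, s.data.outs) = (execList x A c, s.data.outs) := by
      rw [← hA.1]
      simp [M, A]
    have : pre ++ (A ++ loop (pre.length + 2)) ++ post = M := by rw [← hb]
    rw [this, Function.iterate_add_apply, hA']
    exact hrun

/-! ### Initialization: counting the leading ones -/

theorem inputSymbol_eq_one_iff (x : List Bool) (i : ℕ) :
    inputSymbol x i = 1 ↔ x[i]? = some true := by
  unfold inputSymbol
  split <;> simp_all

theorem getElem?_univSize {x : List Bool} {i : ℕ} (hi : i ≤ univSize x) :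
    x[i]? = some true ↔ i < univSize x := by
  induction x generalizing i with
  | nil => simp [univSize]
  | cons b x ih =>
    cases b with
    | false =>
      have : univSize (false :: x) = 0 := rfl
      rw [this] at hi ⊢
      obtain rfl := Nat.le_zero.1 hi
      simp
    | true =>
      have : univSize (true :: x) = univSize x + 1 := rfl
      rw [this] at hi ⊢
      cases i with
      | zero => simp
      | succ i =>
        rw [List.getElem?_cons_succ, ih (by omega)]
        omega

/-- Code that puts `1` into register `1` and the size of the universe into register `3`. -/
def preamble : Program :=
  -- With `v` the symbol read, `v - 1` is positive only beyond the input and `1 - v` only at a zero;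
  -- both cases exit to `8`, the end of this code. Otherwise the symbol is a one and is counted.
  [.const 1 1, .read 0 3, .sub 7 0 1, .jpos 7 8, .sub 7 1 0, .jpos 7 8, .add 3 3 1, .jpos 1 1]

theorem stepOut_preamble (post : Program) (x : List Bool) {k : ℕ} {I : Instr}
    (hk : preamble[k]? = some I) {c : Config} (hc : c.pc = k) (o : List (List Bool)) :
    stepOut (preamble ++ post) x (c, o) = (I.exec ∅ x c, o) := by
  have hf : Program.fetch (preamble ++ post) c = I := by
    have hlt : k < preamble.length := (List.getElem?_eq_some_iff.1 hk).1
    rw [Program.fetch, hc, List.getElem?_append_left hlt, hk]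
    rfl
  have ho : I ≠ .output := by
    rintro rfl
    have := List.mem_of_getElem? hk
    simp [preamble] at this
  simp only [stepOut, hf]

/-- Here `m` is the number of ones still to be counted. Each takes a full round of seven
instructions; the last round leaves after three or five. -/
theorem run_preamble_loop (post : Program) (x : List Bool) (o : List (List Bool)) (m : ℕ) :
    ∀ c : Config, c.pc = 1 → c.reg 1 = 1 → c.reg 3 + m = univSize x →
      ∃ T ≤ 7 * m + 5, ∃ c', c'.pc = 8 ∧ c'.reg 1 = 1 ∧ c'.reg 3 = univSize x ∧
        (∀ r, r ≠ 0 → r ≠ 3 → r ≠ 7 → c'.reg r = c.reg r) ∧ c'.sol = c.sol ∧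
        c'.query = c.query ∧ (stepOut (preamble ++ post) x)^[T] (c, o) = (c', o) := by
  induction m with
  | zero =>
    intro c hc h1 h3
    have hin : inputSymbol x (c.reg 3) ≠ 1 := by
      rw [Ne, inputSymbol_eq_one_iff, getElem?_univSize (by omega)]
      omega
    obtain ⟨v, hv⟩ : ∃ v, v = inputSymbol x (c.reg 3) := ⟨_, rfl⟩
    rw [← hv] at hin
    have e1 := stepOut_preamble post x (k := 1) rfl hc o
    simp only [Instr.exec, ← hv] at e1
    have e2 := stepOut_preamble post x (k := 2) rfl (c := c.write 0 v) (by simp [Config.write, hc]) o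
    have hw : (c.write 0 v).reg 0 - (c.write 0 v).reg 1 = v - 1 := by simp [Config.write, h1]
    simp only [Instr.exec, hw] at e2
    have e3 := stepOut_preamble post x (k := 3) rfl (c := (c.write 0 v).write 7 (v - 1))
      (by simp [Config.write, hc]) o
    have hw' : ((c.write 0 v).write 7 (v - 1)).reg 7 = v - 1 := by simp [Config.write]
    simp only [Instr.exec, hw'] at e3
    by_cases hv2 : 0 < v - 1
    · rw [if_pos hv2] at e3
      refine ⟨3, by omega, { (c.write 0 v).write 7 (v - 1) with pc := 8 }, rfl, ?_, ?_, ?_, rfl,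
        rfl, ?_⟩
      rotate_left 3
      · rw [Function.iterate_succ_apply, Function.iterate_succ_apply, Function.iterate_one, e1, e2,
          e3]
      · simp [Config.write, h1]
      · simpa [Config.write] using h3
      · intro r h0 _ h7
        simp [Config.write, h0, h7]
    · rw [if_neg hv2] at e3
      have hv0 : v = 0 := by omega
      subst hv0
      refine ⟨5, by omega, ⟨8, Function.update (Function.update c.reg 0 0) 7 1, c.query, c.sol⟩, rfl,
        ?_, ?_, ?_, rfl, rfl, ?_⟩
      · simp [h1]
      · simpa using h3
      · intro r h0 _ h7
        simp [h0, h7]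
      · obtain ⟨pc, reg, query, sol⟩ := c
        dsimp only at hc h1 h3 hv
        subst hc
        rw [Function.iterate_succ_apply, Function.iterate_succ_apply, Function.iterate_succ_apply,
          e1, e2, e3, Function.iterate_succ_apply, Function.iterate_one,
          stepOut_preamble post x (k := 4) rfl rfl o]
        simp [Instr.exec, Config.write, h1]
        rw [stepOut_preamble post x (k := 5) rfl rfl o]
        simp [Instr.exec]
  | succ m ih =>
    intro c hc h1 h3
    have hin : inputSymbol x (c.reg 3) = 1 := by
      rw [inputSymbol_eq_one_iff, getElem?_univSize (by omega)]
      omega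
    let d : Config := ⟨1, Function.update (Function.update (Function.update c.reg 0 1) 7 0) 3
      (c.reg 3 + 1), c.query, c.sol⟩
    have hrun : (stepOut (preamble ++ post) x)^[7] (c, o) = (d, o) := by
      obtain ⟨pc, reg, query, sol⟩ := c
      dsimp only at hc h1 h3 hin
      subst hc
      simp only [Function.iterate_succ_apply, Function.iterate_zero, id_eq]
      rw [stepOut_preamble post x (k := 1) rfl rfl o]
      simp only [Instr.exec, Config.write, hin]
      rw [stepOut_preamble post x (k := 2) rfl rfl o]
      simp only [Instr.exec, Config.write]
      rw [stepOut_preamble post x (k := 3) rfl rfl o]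
      simp [Instr.exec, h1]
      rw [stepOut_preamble post x (k := 4) rfl rfl o]
      simp [Instr.exec, Config.write, h1]
      rw [stepOut_preamble post x (k := 5) rfl rfl o]
      simp [Instr.exec]
      rw [stepOut_preamble post x (k := 6) rfl rfl o]
      simp [Instr.exec, Config.write]
      rw [stepOut_preamble post x (k := 7) rfl rfl o]
      simp [Instr.exec, h1, d]
    obtain ⟨T, hT, c', h8, h1', h3', hr, hsol, hq, hrun'⟩ := ih d rfl (by simp [d, h1])
      (by simp [d]; omega)
    refine ⟨T + 7, by omega, c', h8, h1', h3', ?_, hsol, hq, ?_⟩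
    · intro r h0 h3 h7
      rw [hr r h0 h3 h7]
      simp [d, h0, h3, h7]
    · rw [Function.iterate_add_apply, hrun, hrun']

/-- No arrays, no solution, no outputs. -/
def Data.init : Data := ⟨fun _ _ => 0, [], []⟩

/-- Register `7`, which is work register `0`, is left dirty, so only the first-order variables and
the arrays are claimed to be zero. -/
theorem run_preamble (post : Program) (x : List Bool) :
    ∃ T ≤ 7 * x.length + 6, ∃ c s, c.pc = preamble.length ∧ Represents x s c ∧
      s.data = Data.init ∧ (∀ y, s.v (.inl y) = 0) ∧
      (stepOut (preamble ++ post) x)^[T] (Config.init, []) = (c, []) := by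
  have e0 := stepOut_preamble post x (k := 0) rfl (c := Config.init) rfl []
  obtain ⟨T, hT, c, hpc, h1, h3, hr, hsol, hq, hrun⟩ := run_preamble_loop post x [] (univSize x)
    (Config.init.write 1 1) rfl rfl (by simp [Config.init, Config.write])
  have hx := univSize_le x
  have hreg : ∀ r, r ≠ 0 → r ≠ 1 → r ≠ 3 → r ≠ 7 → c.reg r = 0 := by
    intro r h0 h1 h3 h7
    rw [hr r h0 h3 h7]
    simp [Config.init, Config.write, h1]
  refine ⟨T + 1, by omega, c, ⟨fun r => c.reg (phys r), Data.init⟩, hpc,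
    ⟨h1, h3, fun _ => rfl, ?_, hsol, hq⟩, rfl, ?_, ?_⟩
  · intro q a
    obtain ⟨h0, h1, h3⟩ := cell_ne q a
    exact hreg _ h0 h1 h3 (cell_ne_phys q a (.inr 0))
  · intro y
    obtain ⟨h0, h1, h3⟩ := phys_ne (.inl y)
    exact hreg _ h0 h1 h3 (by simp only [phys]; omega)
  · rw [Function.iterate_succ_apply, e0]
    exact hrun

/-- An implemented transformer yields a program with polynomial delay. -/
theorem Impl.exists_enumerates {f : List Bool → MState → MState} (hf : Impl f)
    (F : List Bool → List (List Bool))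
    (hF : ∀ x s, s.data = Data.init → (∀ y, s.v (.inl y) = 0) → (f x s).data.outs = F x) :
    ∃ (M : Program) (p : Polynomial ℕ), ∀ x : List Bool,
      Enumerates M ∅ x (p.eval x.length) Config.init 0 (F x) := by
  obtain ⟨p, l, code, hl, h⟩ := hf
  let M : Program := preamble ++ code preamble.length
  obtain ⟨B, hB, hM⟩ := M.exists_constBound
  let P : Polynomial ℕ := p + 7 * Polynomial.X + Polynomial.C 6
  -- `P` bounds the number of steps including initialization, the second factor the cost of one
  -- step; the final one pays for halting.
  refine ⟨M, P * (1 + 2 * (Polynomial.C B + P)) + 1, fun x => ?_⟩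
  obtain ⟨T, hT, c, s, hc, hs, hdata, henv, hrun⟩ := run_preamble (code preamble.length) x
  obtain ⟨U, hU, c', hc', hs', hrun'⟩ := h preamble [] x s c hc hs
  rw [hF x s hdata henv] at hrun'
  have hTU : U + T ≤ P.eval x.length := by
    simp only [P, Polynomial.eval_add, Polynomial.eval_mul, Polynomial.eval_X, Polynomial.eval_C,
      Polynomial.eval_ofNat]
    omega
  refine enumerates_of_run hM ?_ (U + T) B 0 Config.init [] (F x) c' hB le_rfl ?_ rfl ?_ ?_ ?_
  · exact NoQuery.append (by simp [Program.NoQuery, preamble]) (hl _).2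
  · simp [Config.init]
  · have ho : s.data.outs = [] := by rw [hdata]; rfl
    rw [ho, List.append_nil] at hrun'
    rw [Function.iterate_add_apply, hrun, hrun', List.nil_append]
  · have : M[c'.pc]? = none := by
      rw [List.getElem?_eq_none_iff, hc', List.length_append]
    simp [Program.fetch, this]
  · simp only [Polynomial.eval_add, Polynomial.eval_mul, Polynomial.eval_C, Polynomial.eval_one,
      Polynomial.eval_ofNat, zero_add]
    gcongr

/-! ### Expressions and data transformers -/

/-- `s'` has the same first-order variables as `s`, and the same work registers below `d`, up to
the result register `0`. -/
def Keeps (d : ℕ) (s s' : MState) : Prop :=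
  s'.env = s.env ∧ ∀ j, 0 < j → j < d → s'.v (.inr j) = s.v (.inr j)

theorem Keeps.refl (d : ℕ) (s : MState) : Keeps d s s := ⟨rfl, fun _ _ _ => rfl⟩

theorem Keeps.trans {d : ℕ} {s s' s'' : MState} (h : Keeps d s s') (h' : Keeps d s' s'') :
    Keeps d s s'' :=
  ⟨h'.1.trans h.1, fun j h0 hj => (h'.2 j h0 hj).trans (h.2 j h0 hj)⟩

theorem Keeps.mono {d e : ℕ} {s s' : MState} (h : Keeps e s s') (hd : d ≤ e) : Keeps d s s' :=
  ⟨h.1, fun j h0 hj => h.2 j h0 (hj.trans_le hd)⟩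

theorem Keeps.set_zero (d : ℕ) (s : MState) (a : ℕ) : Keeps d s (s.set (.inr 0) a) :=
  ⟨by funext y; simp [MState.env, MState.set],
    fun j h0 _ => by simp [MState.set, h0.ne']⟩

theorem Keeps.set_work {d j : ℕ} (hj : d ≤ j) (s : MState) (a : ℕ) :
    Keeps d s (s.set (.inr j) a) :=
  ⟨by funext y; simp [MState.env, MState.set], fun i _ hi => by
    simp [MState.set, (hi.trans_le hj).ne]⟩

/-- The function `g` of the input, the arrays and the first-order variables can be evaluated into
work register `0`. -/
def ImplV (g : List Bool → (ℕ → ℕ → ℕ) → (ℕ → ℕ) → ℕ) : Prop :=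
  ∀ d, ∃ F, Impl F ∧ ∀ x s, (F x s).data = s.data ∧ Keeps d s (F x s) ∧
    (F x s).v (.inr 0) = g x s.data.arr s.env

@[simp] theorem MState.set_v (s : MState) (r r' : Reg) (a : ℕ) :
    (s.set r a).v r' = if r' = r then a else s.v r' := by
  simp [MState.set, Function.update_apply]

@[simp] theorem MState.set_data (s : MState) (r : Reg) (a : ℕ) : (s.set r a).data = s.data := rfl

@[simp] theorem MState.env_set_inr (s : MState) (j a : ℕ) : (s.set (.inr j) a).env = s.env := by
  funext y
  simp [MState.env]

@[simp] theorem MState.env_set_inl (s : MState) (y a : ℕ) :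
    (s.set (.inl y) a).env = Function.update s.env y a := by
  funext z
  simp [MState.env, Function.update_apply]

theorem ImplV.const (a : ℕ) : ImplV fun _ _ _ => a := fun d =>
  ⟨_, Impl.const (.inr 0) a, fun _ s => ⟨rfl, Keeps.set_zero d s a, by simp⟩⟩

theorem ImplV.var (y : ℕ) : ImplV fun _ _ u => u y := fun d =>
  ⟨_, Impl.move (.inr 0) (.inl y), fun _ s => ⟨rfl, Keeps.set_zero d s _, by simp [MState.env]⟩⟩

theorem ImplV.unary {op : List Bool → (ℕ → ℕ → ℕ) → ℕ → ℕ}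
    (hop : Impl fun x s => s.set (.inr 0) (op x s.data.arr (s.v (.inr 0))))
    {g : List Bool → (ℕ → ℕ → ℕ) → (ℕ → ℕ) → ℕ} (hg : ImplV g) :
    ImplV fun x A u => op x A (g x A u) := by
  intro d
  obtain ⟨F, hF, h⟩ := hg d
  refine ⟨_, hop.comp hF, fun x s => ?_⟩
  obtain ⟨h1, h2, h3⟩ := h x s
  exact ⟨h1, h2.trans (Keeps.set_zero d _ _), by simp [h1, h3]⟩

/-- The first value is parked in work register `d + 1` while the second is evaluated at level `d +
2`, which protects it. This stack discipline is the reason why `ImplV` quantifies over all levels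
`d`. -/
theorem ImplV.binary {op : ℕ → ℕ → ℕ}
    (hop : ∀ r i j, Impl fun _ s => s.set r (op (s.v i) (s.v j)))
    {g g' : List Bool → (ℕ → ℕ → ℕ) → (ℕ → ℕ) → ℕ} (hg : ImplV g) (hg' : ImplV g') :
    ImplV fun x A u => op (g x A u) (g' x A u) := by
  intro d
  obtain ⟨F, hF, h⟩ := hg d
  obtain ⟨F', hF', h'⟩ := hg' (d + 2)
  refine ⟨_, (hop (.inr 0) (.inr (d + 1)) (.inr 0)).comp
    (hF'.comp ((Impl.move (.inr (d + 1)) (.inr 0)).comp hF)), fun x s => ?_⟩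
  obtain ⟨h1, h2, h3⟩ := h x s
  set s₁ := F x s
  set s₂ := s₁.set (.inr (d + 1)) (s₁.v (.inr 0))
  obtain ⟨h1', h2', h3'⟩ := h' x s₂
  have hk : Keeps d s₁ s₂ := Keeps.set_work (by omega) _ _
  refine ⟨h1'.trans h1, ((h2.trans hk).trans (h2'.mono (by omega))).trans
    (Keeps.set_zero d _ _), ?_⟩
  have hw : (F' x s₂).v (.inr (d + 1)) = g x s.data.arr s.env := by
    rw [h2'.2 _ (by omega) (by omega), ← h3]
    simp [s₂]
  have hw' : (F' x s₂).v (.inr 0) = g' x s.data.arr s.env := by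
    rw [h3', (h2.trans hk).1]
    exact congrArg (fun D : Data => g' x D.arr s.env) h1
  simp [hw, hw']

theorem ImplV.add {g g' : List Bool → (ℕ → ℕ → ℕ) → (ℕ → ℕ) → ℕ} (hg : ImplV g)
    (hg' : ImplV g') : ImplV fun x A u => g x A u + g' x A u :=
  .binary (op := (· + ·)) Impl.add hg hg'

theorem ImplV.sub {g g' : List Bool → (ℕ → ℕ → ℕ) → (ℕ → ℕ) → ℕ} (hg : ImplV g)
    (hg' : ImplV g') : ImplV fun x A u => g x A u - g' x A u :=
  .binary (op := (· - ·)) Impl.sub hg hg'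

theorem ImplV.inp {g : List Bool → (ℕ → ℕ → ℕ) → (ℕ → ℕ) → ℕ} (hg : ImplV g) :
    ImplV fun x A u => inputSymbol x (g x A u) :=
  .unary (op := fun x _ a => inputSymbol x a) (Impl.inp (.inr 0) (.inr 0)) hg

theorem ImplV.arr (q : ℕ) {g : List Bool → (ℕ → ℕ → ℕ) → (ℕ → ℕ) → ℕ} (hg : ImplV g) :
    ImplV fun x A u => A q (g x A u) :=
  .unary (op := fun _ A a => A q a) (Impl.load (.inr 0) q (.inr 0)) hg

theorem ImplV.ite {g g₁ g₂ : List Bool → (ℕ → ℕ → ℕ) → (ℕ → ℕ) → ℕ} (hg : ImplV g)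
    (h₁ : ImplV g₁) (h₂ : ImplV g₂) :
    ImplV fun x A u => if 0 < g x A u then g₁ x A u else g₂ x A u := by
  intro d
  obtain ⟨F, hF, h⟩ := hg d
  obtain ⟨F₁, hF₁, h₁⟩ := h₁ d
  obtain ⟨F₂, hF₂, h₂⟩ := h₂ d
  refine ⟨_, (Impl.ite (.inr 0) hF₁ hF₂).comp hF, fun x s => ?_⟩
  obtain ⟨h1, h2, h3⟩ := h x s
  dsimp only
  rw [h3]
  split
  · obtain ⟨e1, e2, e3⟩ := h₁ x (F x s)
    exact ⟨e1.trans h1, h2.trans e2, by rw [e3, h2.1, h1]⟩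
  · obtain ⟨e1, e2, e3⟩ := h₂ x (F x s)
    exact ⟨e1.trans h1, h2.trans e2, by rw [e3, h2.1, h1]⟩

theorem iterate_induction {α : Type} (f : α → α) (P : ℕ → α → Prop) {n : ℕ} {s : α} (h0 : P 0 s)
    (hs : ∀ i t, P i t → P (i + 1) (f t)) : P n (f^[n] s) := by
  induction n with
  | zero => exact h0
  | succ n ih =>
    rw [Function.iterate_succ_apply']
    exact hs _ _ ih

theorem Impl.addOne (y : ℕ) :
    Impl fun _ s => (s.set (.inr 0) 1).set (.inl y) (s.v (.inl y) + 1) := by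
  have := (Impl.add (.inl y) (.inl y) (.inr 0)).comp (Impl.const (.inr 0) 1)
  simpa using this

/-- Register `d + 1` saves `y`, `d + 2` accumulates, `d + 3` counts rounds, and `g` is evaluated
above them. Multiplication by the size of the universe and both bounded quantifiers are obtained
from such sums. -/
theorem ImplV.sum (y : ℕ) {g : List Bool → (ℕ → ℕ → ℕ) → (ℕ → ℕ) → ℕ} (hg : ImplV g) :
    ImplV fun x A u => ∑ a ∈ Finset.range (univSize x), g x A (Function.update u y a) := by
  intro d
  obtain ⟨G, hG, h⟩ := hg (d + 4)
  let body : List Bool → MState → MState := fun x s =>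
    let s₁ := (G x s).set (.inr (d + 2)) ((G x s).v (.inr (d + 2)) + (G x s).v (.inr 0))
    (s₁.set (.inr 0) 1).set (.inl y) (s₁.v (.inl y) + 1)
  have hbody : Impl body := (Impl.addOne y).comp
    ((Impl.add (.inr (d + 2)) (.inr (d + 2)) (.inr 0)).comp hG)
  have hloop : Impl (repeatSize (d + 3) body) := hbody.repeatSize _ fun x s => by
    simp only [body, MState.set_v, reduceCtorEq, if_false, Sum.inr.injEq]
    rw [if_neg (by omega)]
    exact (h x s).2.1.2 _ (by omega) (by omega)
  refine ⟨_, (Impl.move (.inr 0) (.inr (d + 2))).comp ((Impl.move (.inl y) (.inr (d + 1))).comp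
    (hloop.comp ((Impl.const (.inl y) 0).comp ((Impl.const (.inr (d + 2)) 0).comp
      (Impl.move (.inr (d + 1)) (.inl y)))))), fun x s => ?_⟩
  dsimp only
  set s₀ := ((s.set (.inr (d + 1)) (s.v (.inl y))).set (.inr (d + 2)) 0).set (.inl y) 0 with hs₀
  let P : ℕ → MState → Prop := fun i t => t.data = s.data ∧
    t.env = Function.update s.env y i ∧ (∀ j, 0 < j → j < d → t.v (.inr j) = s.v (.inr j)) ∧
    t.v (.inr (d + 1)) = s.env y ∧
    t.v (.inr (d + 2)) = ∑ a ∈ Finset.range i, g x s.data.arr (Function.update s.env y a)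
  have hP : P (univSize x) (repeatSize (d + 3) body x s₀) := by
    refine iterate_induction _ P ?_ ?_
    · refine ⟨rfl, by simp [s₀], fun j h0 hj => ?_, ?_, ?_⟩
      · simp only [s₀, MState.set_v, Sum.inr.injEq, reduceCtorEq, if_false]
        rw [if_neg (by omega), if_neg (by omega), if_neg (by omega)]
      · simp [s₀, MState.env]
      · simp [s₀]
    · rintro i t ⟨e1, e2, e3, e4, e5⟩
      obtain ⟨h1, h2, h3⟩ := h x t
      have hb : (body x t).env = Function.update s.env y (i + 1) := by
        have : (G x t).v (.inl y) = i := by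
          have := congrFun (h2.1.trans e2) y
          simpa [MState.env] using this
        simp [body, h2.1, e2, this]
      refine ⟨h1.trans e1, by simp [hb], fun j h0 hj => ?_, ?_, ?_⟩
      · rw [MState.set_v, if_neg (by simp; omega)]
        simp only [body, MState.set_v, reduceCtorEq, if_false, Sum.inr.injEq]
        rw [if_neg (by omega), if_neg (by omega), h2.2 j h0 (by omega), e3 j h0 hj]
      · rw [MState.set_v, if_neg (by simp)]
        simp only [body, MState.set_v, reduceCtorEq, if_false, Sum.inr.injEq]
        rw [if_neg (by omega), h2.2 _ (by omega) (by omega), e4]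
      · rw [MState.set_v, if_neg (by simp)]
        simp only [body, MState.set_v, reduceCtorEq, if_false, Sum.inr.injEq]
        rw [if_true, h2.2 _ (by omega) (by omega), e5, h3, e1, e2,
          Finset.sum_range_succ]
  obtain ⟨e1, e2, e3, e4, e5⟩ := hP
  refine ⟨e1, ⟨?_, fun j h0 hj => ?_⟩, ?_⟩
  · simp [e2, e4]
  · simp [h0.ne', e3 j h0 hj]
  · simp [e5]

/-- The transformer `h` of the data, depending on the input and on the first-order variables, is
implemented. -/
def ImplA (h : List Bool → (ℕ → ℕ) → Data → Data) : Prop :=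
  ∀ d, ∃ F, Impl F ∧ ∀ x s, (F x s).data = h x s.env s.data ∧ Keeps d s (F x s)

theorem ImplA.comp {h h' : List Bool → (ℕ → ℕ) → Data → Data} (H' : ImplA h') (H : ImplA h) :
    ImplA fun x u D => h' x u (h x u D) := by
  intro d
  obtain ⟨F, hF, e⟩ := H d
  obtain ⟨F', hF', e'⟩ := H' d
  refine ⟨_, hF'.comp hF, fun x s => ?_⟩
  obtain ⟨e1, e2⟩ := e x s
  obtain ⟨e1', e2'⟩ := e' x (F x s)
  exact ⟨by rw [e1', e2.1, e1], e2.trans e2'⟩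

theorem ImplA.id : ImplA fun _ _ D => D :=
  fun d => ⟨_, Impl.id, fun _ s => ⟨rfl, Keeps.refl d s⟩⟩

theorem ImplA.store (q : ℕ) {g g' : List Bool → (ℕ → ℕ → ℕ) → (ℕ → ℕ) → ℕ} (hg : ImplV g)
    (hg' : ImplV g') : ImplA fun x u D => D.setArr q (g x D.arr u) (g' x D.arr u) := by
  intro d
  obtain ⟨F, hF, h⟩ := hg d
  obtain ⟨F', hF', h'⟩ := hg' (d + 2)
  refine ⟨_, (Impl.store q (.inr (d + 1)) (.inr 0)).comp
    (hF'.comp ((Impl.move (.inr (d + 1)) (.inr 0)).comp hF)), fun x s => ?_⟩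
  obtain ⟨h1, h2, h3⟩ := h x s
  set s₁ := F x s
  set s₂ := s₁.set (.inr (d + 1)) (s₁.v (.inr 0))
  obtain ⟨h1', h2', h3'⟩ := h' x s₂
  have hk : Keeps d s₁ s₂ := Keeps.set_work (by omega) _ _
  have hw : (F' x s₂).v (.inr (d + 1)) = g x s.data.arr s.env := by
    rw [h2'.2 _ (by omega) (by omega), ← h3]
    simp [s₂]
  have hw' : (F' x s₂).v (.inr 0) = g' x s.data.arr s.env := by
    rw [h3', (h2.trans hk).1]
    exact congrArg (fun D : Data => g' x D.arr s.env) h1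
  refine ⟨?_, (h2.trans hk).trans (h2'.mono (by omega))⟩
  have hd : (F' x s₂).data = s.data := h1'.trans h1
  simp only [hw, hw', hd]

theorem ImplA.outBit {g : List Bool → (ℕ → ℕ → ℕ) → (ℕ → ℕ) → ℕ} (hg : ImplV g) :
    ImplA fun x u D => { D with sol := D.sol ++ [decide (0 < g x D.arr u)] } := by
  intro d
  obtain ⟨F, hF, h⟩ := hg d
  refine ⟨_, (Impl.outBit (.inr 0)).comp hF, fun x s => ?_⟩
  obtain ⟨h1, h2, h3⟩ := h x s
  refine ⟨?_, h2⟩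
  simp only [h1, h3]

theorem ImplA.output : ImplA fun _ _ D => ⟨D.arr, [], D.outs ++ [D.sol]⟩ :=
  fun d => ⟨_, Impl.output, fun _ s => ⟨rfl, Keeps.refl d s⟩⟩

theorem ImplA.ite {g : List Bool → (ℕ → ℕ → ℕ) → (ℕ → ℕ) → ℕ} (hg : ImplV g)
    {h₁ h₂ : List Bool → (ℕ → ℕ) → Data → Data} (H₁ : ImplA h₁) (H₂ : ImplA h₂) :
    ImplA fun x u D => if 0 < g x D.arr u then h₁ x u D else h₂ x u D := by
  intro d
  obtain ⟨F, hF, h⟩ := hg d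
  obtain ⟨F₁, hF₁, h₁⟩ := H₁ d
  obtain ⟨F₂, hF₂, h₂⟩ := H₂ d
  refine ⟨_, (Impl.ite (.inr 0) hF₁ hF₂).comp hF, fun x s => ?_⟩
  obtain ⟨h1, h2, h3⟩ := h x s
  dsimp only
  rw [h3]
  split
  · obtain ⟨e1, e2⟩ := h₁ x (F x s)
    exact ⟨by rw [e1, h2.1, h1], h2.trans e2⟩
  · obtain ⟨e1, e2⟩ := h₂ x (F x s)
    exact ⟨by rw [e1, h2.1, h1], h2.trans e2⟩

theorem ImplA.repeatSize {h : List Bool → (ℕ → ℕ) → Data → Data} (H : ImplA h) :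
    ImplA fun x u D => (h x u)^[univSize x] D := by
  intro d
  obtain ⟨F, hF, e⟩ := H (d + 2)
  refine ⟨_, hF.repeatSize (d + 1) fun x s => (e x s).2.2 _ (by omega) (by omega), fun x s => ?_⟩
  let P : ℕ → MState → Prop := fun i t => t.data = (h x s.env)^[i] s.data ∧ Keeps d s t
  refine iterate_induction _ P ⟨rfl, Keeps.set_work (by omega) _ _⟩ ?_
  rintro i t ⟨e1, e2⟩
  obtain ⟨e1', e2'⟩ := e x t
  refine ⟨?_, (e2.trans (e2'.mono (by omega))).trans (Keeps.set_work (by omega) _ _)⟩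
  rw [Function.iterate_succ_apply', MState.set_data, e1', e1, e2.1]

theorem ImplA.forVar (y : ℕ) {h : List Bool → (ℕ → ℕ) → Data → Data} (H : ImplA h) :
    ImplA fun x u D => (List.range (univSize x)).foldl
      (fun D a => h x (Function.update u y a) D) D := by
  intro d
  obtain ⟨G, hG, h'⟩ := H (d + 3)
  let body : List Bool → MState → MState := fun x s =>
    ((G x s).set (.inr 0) 1).set (.inl y) ((G x s).v (.inl y) + 1)
  have hbody : Impl body := (Impl.addOne y).comp hG
  have hloop : Impl (TeamEnum.repeatSize (d + 2) body) := hbody.repeatSize _ fun x s => by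
    simp only [body, MState.set_v, reduceCtorEq, if_false, Sum.inr.injEq]
    exact (h' x s).2.2 _ (by omega) (by omega)
  refine ⟨_, (Impl.move (.inl y) (.inr (d + 1))).comp
    (hloop.comp ((Impl.const (.inl y) 0).comp (Impl.move (.inr (d + 1)) (.inl y)))), fun x s => ?_⟩
  dsimp only
  set s₀ := (s.set (.inr (d + 1)) (s.v (.inl y))).set (.inl y) 0 with hs₀
  let P : ℕ → MState → Prop := fun i t => t.data = (List.range i).foldl
      (fun D a => h x (Function.update s.env y a) D) s.data ∧
    t.env = Function.update s.env y i ∧ (∀ j, 0 < j → j < d → t.v (.inr j) = s.v (.inr j)) ∧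
    t.v (.inr (d + 1)) = s.env y
  have hP : P (univSize x) (TeamEnum.repeatSize (d + 2) body x s₀) := by
    refine iterate_induction _ P ?_ ?_
    · refine ⟨rfl, by simp [s₀], fun j h0 hj => ?_, ?_⟩
      · simp only [s₀, MState.set_v, Sum.inr.injEq, reduceCtorEq, if_false]
        rw [if_neg (by omega), if_neg (by omega)]
      · simp [s₀, MState.env]
    · rintro i t ⟨e1, e2, e3, e4⟩
      obtain ⟨h1, h2⟩ := h' x t
      have hb : (body x t).env = Function.update s.env y (i + 1) := by
        have : (G x t).v (.inl y) = i := by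
          have := congrFun (h2.1.trans e2) y
          simpa [MState.env] using this
        simp [body, h2.1, e2, this]
      refine ⟨?_, by simp [hb], fun j h0 hj => ?_, ?_⟩
      · rw [List.range_succ, List.foldl_append, List.foldl_cons, List.foldl_nil, ← e1, ← e2]
        exact h1
      · rw [MState.set_v, if_neg (by simp; omega)]
        simp only [body, MState.set_v, reduceCtorEq, if_false, Sum.inr.injEq]
        rw [if_neg (by omega), h2.2 j h0 (by omega), e3 j h0 hj]
      · rw [MState.set_v, if_neg (by simp)]
        simp only [body, MState.set_v, reduceCtorEq, if_false, Sum.inr.injEq]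
        rw [h2.2 _ (by omega) (by omega), e4]
  obtain ⟨e1, e2, e3, e4⟩ := hP
  refine ⟨e1, ?_, fun j h0 hj => ?_⟩
  · simp [e2, e4]
  · simp [e3 j h0 hj]

theorem ImplA.exists_enumerates {h : List Bool → (ℕ → ℕ) → Data → Data} (H : ImplA h) :
    ∃ (M : Program) (p : Polynomial ℕ), ∀ x : List Bool,
      Enumerates M ∅ x (p.eval x.length) Config.init 0 (h x (fun _ => 0) Data.init).outs := by
  obtain ⟨F, hF, e⟩ := H 0
  refine hF.exists_enumerates _ fun x s hs hv => ?_
  rw [(e x s).1, hs]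
  have : s.env = fun _ => 0 := funext hv
  rw [this]

/-! ### Positions of tuples, and loops over tuples -/

/-- The position of the tuple of values of the variables in the list `l`. -/
def tupleIdx (n : ℕ) : List ℕ → (ℕ → ℕ) → ℕ
  | [], _ => 0
  | v :: l, u => u v + n * tupleIdx n l u

theorem tupleIdx_congr (n : ℕ) {l : List ℕ} {u u' : ℕ → ℕ} (h : ∀ v ∈ l, u v = u' v) :
    tupleIdx n l u = tupleIdx n l u' := by
  induction l with
  | nil => rfl
  | cons v l ih =>
    simp only [tupleIdx]
    rw [h v (by simp), ih fun w hw => h w (by simp [hw])]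

theorem tupleIdx_lt {n : ℕ} {l : List ℕ} {u : ℕ → ℕ} (h : ∀ v ∈ l, u v < n) :
    tupleIdx n l u < n ^ l.length := by
  induction l with
  | nil => simp [tupleIdx]
  | cons v l ih =>
    have h1 := h v (by simp)
    have h2 := ih fun w hw => h w (by simp [hw])
    simp only [tupleIdx, List.length_cons, pow_succ']
    calc u v + n * tupleIdx n l u < n + n * tupleIdx n l u := by omega
      _ = n * (tupleIdx n l u + 1) := by ring
      _ ≤ n * n ^ l.length := Nat.mul_le_mul_left _ h2

theorem tupleIdx_inj {n : ℕ} {l : List ℕ} {u u' : ℕ → ℕ} (h : ∀ v ∈ l, u v < n)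
    (h' : ∀ v ∈ l, u' v < n) (he : tupleIdx n l u = tupleIdx n l u') : ∀ v ∈ l, u v = u' v := by
  induction l with
  | nil => simp
  | cons v l ih =>
    have h1 := h v (by simp)
    have h1' := h' v (by simp)
    simp only [tupleIdx] at he
    have e1 : u v = u' v := by
      have := congrArg (· % n) he
      simpa [Nat.add_mul_mod_self_left, Nat.mod_eq_of_lt, h1, h1'] using this
    have e2 : tupleIdx n l u = tupleIdx n l u' := by
      rw [e1] at he
      exact Nat.eq_of_mul_eq_mul_left (by omega) (Nat.add_left_cancel he)
    intro w hw
    rcases List.mem_cons.1 hw with rfl | hw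
    · exact e1
    · exact ih (fun w hw => h w (by simp [hw])) (fun w hw => h' w (by simp [hw])) e2 w hw

theorem tupleIdx_ofFn (n : ℕ) {k : ℕ} (e : Fin k → ℕ) (u : ℕ → ℕ) :
    tupleIdx n (List.ofFn e) u = ∑ i, u (e i) * n ^ (i : ℕ) := by
  induction k with
  | zero => simp [tupleIdx]
  | succ k ih =>
    rw [List.ofFn_succ, tupleIdx, ih, Fin.sum_univ_succ, Finset.mul_sum]
    simp only [Fin.val_zero, pow_zero, mul_one, Fin.val_succ, pow_succ]
    congr 1
    exact Finset.sum_congr rfl fun i _ => by ring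

theorem ImplV.tupleIdx (l : List ℕ) : ImplV fun x _ u => tupleIdx (univSize x) l u := by
  induction l with
  | nil => exact .const 0
  | cons v l ih =>
    -- Multiplication by `n` is summation over the `n` values of a variable `y` on which the summand
    -- does not depend.
    obtain ⟨y, hy⟩ := Infinite.exists_notMem_finset l.toFinset
    convert (ImplV.var v).add (ih.sum y) using 4 with x A u
    rw [Finset.sum_congr rfl fun a _ => tupleIdx_congr (univSize x) (u' := u) fun w hw => ?_]
    · simp [TeamEnum.tupleIdx]
    · refine Function.update_of_ne ?_ _ _
      rintro rfl
      simp [hw] at hy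

theorem ImplV.pow (k : ℕ) : ImplV fun x _ _ => univSize x ^ k := by
  induction k with
  | zero => simpa using ImplV.const 1
  | succ k ih =>
    convert ih.sum 0 using 4 with x
    simp [pow_succ']

theorem ImplV.powSum (l : List ℕ) : ImplV fun x _ _ => (l.map (univSize x ^ ·)).sum := by
  induction l with
  | nil => simpa using ImplV.const 0
  | cons k l ih => simpa using (ImplV.pow k).add ih

theorem ImplA.repeatPow {h : List Bool → (ℕ → ℕ) → Data → Data} (H : ImplA h) (k : ℕ) :
    ImplA fun x u D => (h x u)^[univSize x ^ k] D := by
  induction k with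
  | zero => simpa using H
  | succ k ih => simpa only [pow_succ, Function.iterate_mul] using ih.repeatSize

theorem ImplA.repeatSuccPow {h : List Bool → (ℕ → ℕ) → Data → Data} (H : ImplA h) (k : ℕ) :
    ImplA fun x u D => (h x u)^[(univSize x + 1) ^ k] D := by
  induction k with
  | zero => simpa using H
  | succ k ih =>
    simpa only [pow_succ, Function.iterate_mul, Function.iterate_succ_apply'] using
      ih.comp ih.repeatSize

/-! ### Loops over all tuples, and parallel assignment to an array -/

/-- All ways to change the values of the variables in `l` to numbers below `n`. -/
def envs (n : ℕ) : List ℕ → (ℕ → ℕ) → List (ℕ → ℕ)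
  | [], u => [u]
  | v :: l, u => (List.range n).flatMap fun a => envs n l (Function.update u v a)

theorem mem_envs {n : ℕ} {l : List ℕ} {u u' : ℕ → ℕ} :
    u' ∈ envs n l u ↔ (∀ v ∈ l, u' v < n) ∧ ∀ v ∉ l, u' v = u v := by
  induction l generalizing u with
  | nil => simp [envs, funext_iff]
  | cons y l ih =>
    simp only [envs, List.mem_flatMap, List.mem_range, ih]
    constructor
    · rintro ⟨a, ha, h1, h2⟩
      refine ⟨fun v hv => ?_, fun v hv => ?_⟩
      · by_cases hvl : v ∈ l
        · exact h1 v hvl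
        · obtain rfl : v = y := by simpa [hvl] using hv
          rw [h2 v hvl, Function.update_self]
          exact ha
      · simp only [List.mem_cons, not_or] at hv
        rw [h2 v hv.2, Function.update_of_ne hv.1]
    · rintro ⟨h1, h2⟩
      refine ⟨u' y, h1 y (by simp), fun v hv => h1 v (by simp [hv]), fun v hv => ?_⟩
      by_cases hvy : v = y
      · subst hvy
        rw [Function.update_self]
      · rw [Function.update_of_ne hvy, h2 v (by simp [hvy, hv])]

theorem ImplA.forAll (l : List ℕ) {h : List Bool → (ℕ → ℕ) → Data → Data} (H : ImplA h) :
    ImplA fun x u D => (envs (univSize x) l u).foldl (fun D u' => h x u' D) D := by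
  induction l with
  | nil => simpa [envs] using H
  | cons y l ih => simpa only [envs, List.foldl_flatMap] using ih.forVar y

/-- Apart from the buffer `0`, the arrays below `q` and the output remain the same. -/
structure Data.Preserves (q : ℕ) (D D' : Data) : Prop where
  sol : D'.sol = D.sol
  outs : D'.outs = D.outs
  arr : ∀ r, 0 < r → r < q → D'.arr r = D.arr r

theorem Data.Preserves.refl (q : ℕ) (D : Data) : D.Preserves q D := ⟨rfl, rfl, fun _ _ _ => rfl⟩

theorem Data.Preserves.trans {q : ℕ} {D D' D'' : Data} (h : D.Preserves q D')
    (h' : D'.Preserves q D'') : D.Preserves q D'' :=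
  ⟨h'.sol.trans h.sol, h'.outs.trans h.outs, fun r h0 hr => (h'.arr r h0 hr).trans (h.arr r h0 hr)⟩

theorem Data.Preserves.mono {q q' : ℕ} {D D' : Data} (h : D.Preserves q' D') (hq : q ≤ q') :
    D.Preserves q D' :=
  ⟨h.sol, h.outs, fun r h0 hr => h.arr r h0 (hr.trans_le hq)⟩

/-- The function `g` does not read the array `q`. -/
def IgnoresArray (q : ℕ) (g : List Bool → (ℕ → ℕ → ℕ) → (ℕ → ℕ) → ℕ) : Prop :=
  ∀ x A A' u, (∀ r, r ≠ q → A r = A' r) → g x A u = g x A' u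

open Classical in
/-- A loop over tuples that writes `c` at position `ix` whenever `g` is positive. -/
theorem exists_scatter (q c : ℕ) (l : List ℕ) {ix : List Bool → (ℕ → ℕ) → ℕ}
    {g : List Bool → (ℕ → ℕ → ℕ) → (ℕ → ℕ) → ℕ} (hix : ImplV fun x _ u => ix x u) (hg : ImplV g)
    (hgq : IgnoresArray q g) :
    ∃ h, ImplA h ∧ ∀ x u D, (h x u D).sol = D.sol ∧ (h x u D).outs = D.outs ∧
      (∀ r, r ≠ q → (h x u D).arr r = D.arr r) ∧
      ∀ p, (h x u D).arr q p =
        if ∃ u' ∈ envs (univSize x) l u, 0 < g x D.arr u' ∧ ix x u' = p then c else D.arr q p := by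
  refine ⟨_, (ImplA.ite hg (ImplA.store q hix (.const c)) ImplA.id).forAll l, fun x u D => ?_⟩
  generalize envs (univSize x) l u = L
  induction L generalizing D with
  | nil => simp
  | cons v L ih =>
    rw [List.foldl_cons]
    set D₁ := if 0 < g x D.arr v then D.setArr q (ix x v) c else D with hD₁
    obtain ⟨h1, h2, h3, h4⟩ := ih D₁
    have hsol : D₁.sol = D.sol := by rw [hD₁]; split <;> rfl
    have houts : D₁.outs = D.outs := by rw [hD₁]; split <;> rfl
    have hr : ∀ r, r ≠ q → D₁.arr r = D.arr r := by
      intro r hr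
      rw [hD₁]
      split
      · exact Function.update_of_ne hr _ _
      · rfl
    refine ⟨h1.trans hsol, h2.trans houts, fun r hrq => (h3 r hrq).trans (hr r hrq), fun p => ?_⟩
    -- Since `g` does not read `q`, earlier writes of the loop do not influence later tests.
    have hg' : ∀ u', g x D₁.arr u' = g x D.arr u' := fun u' => hgq _ _ _ _ hr
    have hp : D₁.arr q p = if 0 < g x D.arr v ∧ ix x v = p then c else D.arr q p := by
      rw [hD₁]
      by_cases hv : 0 < g x D.arr v
      · simp [hv, Data.setArr, Function.update_apply, eq_comm]
      · simp [hv]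
    rw [h4, hp]
    simp only [hg', List.mem_cons, exists_eq_or_imp]
    by_cases ha : ∃ u' ∈ L, 0 < g x D.arr u' ∧ ix x u' = p
    · simp [ha]
    · simp [ha]

theorem eq_of_mem_envs {n : ℕ} {l : List ℕ} {u u₁ u₂ : ℕ → ℕ} (h₁ : u₁ ∈ envs n l u)
    (h₂ : u₂ ∈ envs n l u) (h : tupleIdx n l u₁ = tupleIdx n l u₂) : u₁ = u₂ := by
  rw [mem_envs] at h₁ h₂
  funext v
  by_cases hv : v ∈ l
  · exact tupleIdx_inj h₁.1 h₂.1 h v hv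
  · rw [h₁.2 v hv, h₂.2 v hv]

/-- A parallel assignment: the array `q` becomes the set of the tuples at which `g` is positive. -/
theorem exists_parallelAssign {q : ℕ} (hq : 0 < q) (l : List ℕ)
    {g : List Bool → (ℕ → ℕ → ℕ) → (ℕ → ℕ) → ℕ} (hg : ImplV g) (hg0 : IgnoresArray 0 g) :
    ∃ h, ImplA h ∧ ∀ x u D, (h x u D).sol = D.sol ∧ (h x u D).outs = D.outs ∧
      (∀ r, 0 < r → r ≠ q → (h x u D).arr r = D.arr r) ∧
      ∀ u' ∈ envs (univSize x) l u,
        (0 < (h x u D).arr q (tupleIdx (univSize x) l u') ↔ 0 < g x D.arr u') := by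
  have hone : ∀ r, IgnoresArray r fun _ _ _ => 1 := fun _ _ _ _ _ _ => rfl
  -- Four loops: clear the buffer `0`, record there where `g` is positive, clear `q`, copy the
  -- buffer into `q`. The detour lets `g` read the old contents of `q`.
  obtain ⟨h₁, H₁, s₁⟩ := exists_scatter 0 0 l (.tupleIdx l) (.const 1) (hone 0)
  obtain ⟨h₂, H₂, s₂⟩ := exists_scatter 0 1 l (.tupleIdx l) hg hg0
  obtain ⟨h₃, H₃, s₃⟩ := exists_scatter q 0 l (.tupleIdx l) (.const 1) (hone q)
  obtain ⟨h₄, H₄, s₄⟩ := exists_scatter q 1 l (.tupleIdx l) ((ImplV.tupleIdx l).arr 0)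
    (fun x A A' u h => by simp only [h 0 hq.ne])
  refine ⟨_, H₄.comp (H₃.comp (H₂.comp H₁)), fun x u D => ?_⟩
  obtain ⟨a₁, b₁, c₁, d₁⟩ := s₁ x u D
  obtain ⟨a₂, b₂, c₂, d₂⟩ := s₂ x u (h₁ x u D)
  obtain ⟨a₃, b₃, c₃, d₃⟩ := s₃ x u (h₂ x u (h₁ x u D))
  obtain ⟨a₄, b₄, c₄, d₄⟩ := s₄ x u (h₃ x u (h₂ x u (h₁ x u D)))
  have hinj : ∀ u₁ ∈ envs (univSize x) l u, ∀ u₂ ∈ envs (univSize x) l u,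
      (tupleIdx (univSize x) l u₁ = tupleIdx (univSize x) l u₂ ↔ u₁ = u₂) :=
    fun u₁ h₁ u₂ h₂ => ⟨eq_of_mem_envs h₁ h₂, fun h => h ▸ rfl⟩
  refine ⟨by rw [a₄, a₃, a₂, a₁], by rw [b₄, b₃, b₂, b₁], fun r h0 hr => ?_, fun u' hu' => ?_⟩
  · rw [c₄ r hr, c₃ r hr, c₂ r h0.ne', c₁ r h0.ne']
  · have hg' : ∀ v, g x (h₁ x u D).arr v = g x D.arr v :=
      fun v => hg0 _ _ _ _ fun r hr => c₁ r hr
    have e₃ : (h₃ x u (h₂ x u (h₁ x u D))).arr q (tupleIdx (univSize x) l u') = 0 := by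
      rw [d₃, if_pos ⟨u', hu', one_pos, rfl⟩]
    have e₁ : (h₁ x u D).arr 0 (tupleIdx (univSize x) l u') = 0 := by
      rw [d₁, if_pos ⟨u', hu', one_pos, rfl⟩]
    have e₂ : 0 < (h₂ x u (h₁ x u D)).arr 0 (tupleIdx (univSize x) l u') ↔
        0 < g x D.arr u' := by
      rw [d₂, e₁]
      split
      next h =>
        obtain ⟨v, hv, hgv, hvu⟩ := h
        rw [hinj v hv u' hu'] at hvu
        subst hvu
        rw [hg'] at hgv
        simp [hgv]
      next h =>
        push Not at h
        have := h u' hu'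
        rw [hg'] at this
        by_contra hc
        exact this (Nat.pos_of_ne_zero (by simpa using hc)) rfl
    rw [d₄, e₃, ← e₂, ← c₃ 0 hq.ne]
    split
    next h =>
      obtain ⟨v, hv, hgv, hvu⟩ := h
      rw [hinj v hv u' hu'] at hvu
      subst hvu
      simpa using hgv
    next h =>
      push Not at h
      have := h u' hu'
      by_contra hc
      exact this (Nat.pos_of_ne_zero (by simpa using hc)) rfl

/-! ### Teams in memory -/

/-- The variables of a finite set in increasing order. -/
def varList (D : Finset ℕ) : List ℕ := List.ofFn (D.orderEmbOfFin rfl)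

theorem mem_varList {D : Finset ℕ} {v : ℕ} : v ∈ varList D ↔ v ∈ D := by
  rw [varList, List.mem_ofFn]
  exact Set.ext_iff.1 (D.range_orderEmbOfFin rfl) v

theorem length_varList (D : Finset ℕ) : (varList D).length = D.card := by simp [varList]

/-- The values of an assignment, being `0` outside of its domain. -/
def Assignment.val {n : ℕ} (s : Assignment (Fin n)) (v : ℕ) : ℕ := (s v).elim 0 Fin.val

theorem Assignment.val_of_eq_some {n : ℕ} {s : Assignment (Fin n)} {v : ℕ} {a : Fin n}
    (h : s v = some a) : s.val v = a := by simp [Assignment.val, h]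

theorem Assignment.val_supp {n : ℕ} (s : Assignment (Fin n)) (x : ℕ) (a : Fin n) :
    (s.supp x a).val = Function.update s.val x a := by
  funext v
  by_cases hv : v = x
  · subst hv
    simp [Assignment.val, Assignment.supp]
  · simp [Assignment.val, Assignment.supp, hv]

theorem exists_of_mem_fullTeam {A : Type} {D : Finset ℕ} {s : Assignment A}
    (hs : s ∈ fullTeam D A) {v : ℕ} (hv : v ∈ D) : ∃ a, s v = some a :=
  Option.ne_none_iff_exists'.1 ((hs v).2 hv)

theorem eq_none_of_mem_fullTeam {A : Type} {D : Finset ℕ} {s : Assignment A}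
    (hs : s ∈ fullTeam D A) {v : ℕ} (hv : v ∉ D) : s v = none := by
  by_contra h
  exact hv ((hs v).1 h)

/-- Together with `eq_of_val_eq` and `exists_val_eq` this identifies assignments with domain `D`
with the environments visited by a loop over `D` started from zero; the default value `0` of
`Assignment.val` matches that start. -/
theorem val_mem_envs {n : ℕ} {D : Finset ℕ} {s : Assignment (Fin n)}
    (hs : s ∈ fullTeam D (Fin n)) : s.val ∈ envs n (varList D) fun _ => 0 := by
  rw [mem_envs]
  refine ⟨fun v hv => ?_, fun v hv => ?_⟩
  · obtain ⟨a, ha⟩ := exists_of_mem_fullTeam hs (mem_varList.1 hv)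
    rw [Assignment.val_of_eq_some ha]
    exact a.2
  · have := eq_none_of_mem_fullTeam hs (fun h => hv (mem_varList.2 h))
    simp [Assignment.val, this]

theorem eq_of_val_eq {n : ℕ} {D : Finset ℕ} {s t : Assignment (Fin n)}
    (hs : s ∈ fullTeam D (Fin n)) (ht : t ∈ fullTeam D (Fin n)) (h : ∀ v ∈ D, s.val v = t.val v) :
    s = t := by
  funext v
  by_cases hv : v ∈ D
  · obtain ⟨a, ha⟩ := exists_of_mem_fullTeam hs hv
    obtain ⟨b, hb⟩ := exists_of_mem_fullTeam ht hv
    have := h v hv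
    rw [Assignment.val_of_eq_some ha, Assignment.val_of_eq_some hb] at this
    rw [ha, hb, Fin.ext this]
  · rw [eq_none_of_mem_fullTeam hs hv, eq_none_of_mem_fullTeam ht hv]

theorem exists_val_eq {n : ℕ} {D : Finset ℕ} {u : ℕ → ℕ}
    (hu : u ∈ envs n (varList D) fun _ => 0) : ∃ s ∈ fullTeam D (Fin n), s.val = u := by
  rw [mem_envs] at hu
  refine ⟨fun v => if h : v ∈ D then some ⟨u v, hu.1 v (mem_varList.2 h)⟩ else none,
    fun v => by simp, funext fun v => ?_⟩
  by_cases hv : v ∈ D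
  · simp [Assignment.val, hv]
  · simp [Assignment.val, hv, hu.2 v (fun h => hv (mem_varList.1 h))]

theorem finite_fullTeam (D : Finset ℕ) (n : ℕ) :
    (fullTeam D (Fin n)).Finite ∧ (fullTeam D (Fin n)).ncard ≤ n ^ D.card := by
  have hinj : Set.InjOn (fun s : Assignment (Fin n) => tupleIdx n (varList D) s.val)
      (fullTeam D (Fin n)) := fun s hs t ht h =>
    eq_of_val_eq hs ht fun v _ => congrFun (eq_of_mem_envs (val_mem_envs hs) (val_mem_envs ht) h) v
  have hmaps : ∀ s ∈ fullTeam D (Fin n), tupleIdx n (varList D) s.val ∈ Set.Iio (n ^ D.card) := by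
    intro s hs
    rw [Set.mem_Iio, ← length_varList D]
    exact tupleIdx_lt (mem_envs.1 (val_mem_envs hs)).1
  refine ⟨Set.Finite.of_injOn hmaps hinj (Set.finite_Iio _), ?_⟩
  refine (Set.ncard_le_ncard_of_injOn _ hmaps hinj (Set.finite_Iio _)).trans ?_
  rw [Set.ncard_eq_toFinset_card', Set.toFinset_Iio, Nat.card_Iio]

/-- The team with domain `D` stored in an array. -/
def storedTeam (n : ℕ) (D : Finset ℕ) (A : ℕ → ℕ) : Set (Assignment (Fin n)) :=
  {s | s ∈ fullTeam D (Fin n) ∧ 0 < A (tupleIdx n (varList D) s.val)}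

/-- The form of `exists_parallelAssign` for teams. The old team in `q` may occur in `g`, so updates
in place are covered. -/
theorem exists_assign {q : ℕ} (hq : 0 < q) (D : Finset ℕ)
    {g : List Bool → (ℕ → ℕ → ℕ) → (ℕ → ℕ) → ℕ} (hg : ImplV g) (hg0 : IgnoresArray 0 g) :
    ∃ h, ImplA h ∧ ∀ (x : List Bool) (n : ℕ), univSize x = n → ∀ d : Data,
      d.Preserves q (h x (fun _ => 0) d) ∧
      (∀ r, 0 < r → r ≠ q → (h x (fun _ => 0) d).arr r = d.arr r) ∧
      storedTeam n D ((h x (fun _ => 0) d).arr q) =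
        {s | s ∈ fullTeam D (Fin n) ∧ 0 < g x d.arr s.val} := by
  obtain ⟨h, H, hs⟩ := exists_parallelAssign hq (varList D) hg hg0
  refine ⟨h, H, fun x n hn d => ?_⟩
  subst hn
  obtain ⟨h1, h2, h3, h4⟩ := hs x (fun _ => 0) d
  refine ⟨⟨h1, h2, fun r h0 hr => h3 r h0 hr.ne⟩, h3, ?_⟩
  ext s
  simp only [storedTeam, Set.mem_ofPred_eq]
  exact and_congr_right fun hs => h4 _ (val_mem_envs hs)

/-- Remove from the array `q` the tuples at which `g` vanishes. -/
theorem exists_filter {q : ℕ} (hq : 0 < q) (D : Finset ℕ)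
    {g : List Bool → (ℕ → ℕ → ℕ) → (ℕ → ℕ) → ℕ} (hg : ImplV g) (hg0 : IgnoresArray 0 g) :
    ∃ h, ImplA h ∧ ∀ (x : List Bool) (n : ℕ), univSize x = n → ∀ d : Data,
      d.Preserves q (h x (fun _ => 0) d) ∧
      storedTeam n D ((h x (fun _ => 0) d).arr q) =
        {s | s ∈ storedTeam n D (d.arr q) ∧ 0 < g x d.arr s.val} := by
  obtain ⟨h, H, hs⟩ := exists_assign hq D
    (g := fun x A u => if 0 < A q (tupleIdx (univSize x) (varList D) u) then g x A u else 0)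
    (ImplV.ite ((ImplV.tupleIdx _).arr q) hg (.const 0)) (fun x A A' u h => by
      simp only [h q hq.ne', hg0 x A A' u h])
  refine ⟨h, H, fun x n hn d => ?_⟩
  obtain ⟨h1, -, h3⟩ := hs x n hn d
  refine ⟨h1, h3.trans ?_⟩
  subst hn
  ext s
  simp only [storedTeam, Set.mem_ofPred_eq, and_assoc]
  refine and_congr_right fun _ => ?_
  split <;> simp_all

theorem storedTeam_subset (n : ℕ) (D : Finset ℕ) (A : ℕ → ℕ) :
    storedTeam n D A ⊆ fullTeam D (Fin n) := fun _ h => h.1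

/-- Iterating an operation on a stored team. -/
theorem iterate_storedTeam {n q : ℕ} {D : Finset ℕ} {f : Data → Data}
    {F : Set (Assignment (Fin n)) → Set (Assignment (Fin n))}
    (hf : ∀ d : Data, d.Preserves q (f d) ∧
      storedTeam n D ((f d).arr q) = F (storedTeam n D (d.arr q))) (N : ℕ) (d : Data) :
    d.Preserves q (f^[N] d) ∧
      storedTeam n D ((f^[N] d).arr q) = F^[N] (storedTeam n D (d.arr q)) := by
  induction N with
  | zero => exact ⟨.refl _ _, rfl⟩
  | succ N ih =>
    rw [Function.iterate_succ_apply', Function.iterate_succ_apply']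
    obtain ⟨h1, h2⟩ := hf (f^[N] d)
    exact ⟨ih.1.trans h1, by rw [h2, ih.2]⟩

/-! ### The greatest satisfying subteam -/

/-- Literals speak about single assignments, and the witness for an inclusion atom stays available
in a larger team. Splittings for disjunctions and choices for quantifiers can be united, because lax
semantics allows overlapping halves and several values. For `C = ∅` this is satisfaction by the
empty team. -/
theorem sat_sUnion {σ : Vocabulary} {A : Type} (S : Struct σ A) (φ : InclFormula σ) :
    ∀ C : Set (Set (Assignment A)), (∀ X ∈ C, Sat S φ X) → Sat S φ (⋃₀ C) := by
  induction φ with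
  | eq x y => rintro C h s ⟨X, hX, hs⟩; exact h X hX s hs
  | neq x y => rintro C h s ⟨X, hX, hs⟩; exact h X hX s hs
  | rel i x => rintro C h s ⟨X, hX, hs⟩; exact h X hX s hs
  | nrel i x => rintro C h s ⟨X, hX, hs⟩; exact h X hX s hs
  | incl m x y =>
    rintro C h s ⟨X, hX, hs⟩
    obtain ⟨t, ht, he⟩ := h X hX s hs
    exact ⟨t, ⟨X, hX, ht⟩, he⟩
  | and φ ψ ihφ ihψ =>
    exact fun C h => ⟨ihφ C fun X hX => (h X hX).1, ihψ C fun X hX => (h X hX).2⟩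
  | or φ ψ ihφ ihψ =>
    intro C h
    choose! Y Z hY hZ hYZ hφ hψ using h
    refine ⟨⋃₀ (Y '' C), ⋃₀ (Z '' C), ?_, ?_, ?_, ihφ _ ?_, ihψ _ ?_⟩
    · rintro s ⟨_, ⟨X, hX, rfl⟩, hs⟩
      exact ⟨X, hX, hY X hX hs⟩
    · rintro s ⟨_, ⟨X, hX, rfl⟩, hs⟩
      exact ⟨X, hX, hZ X hX hs⟩
    · ext s
      constructor
      · rintro (⟨_, ⟨X, hX, rfl⟩, hs⟩ | ⟨_, ⟨X, hX, rfl⟩, hs⟩)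
        · exact ⟨X, hX, hY X hX hs⟩
        · exact ⟨X, hX, hZ X hX hs⟩
      · rintro ⟨X, hX, hs⟩
        rw [← hYZ X hX] at hs
        exact hs.imp (fun h => ⟨_, ⟨X, hX, rfl⟩, h⟩) fun h => ⟨_, ⟨X, hX, rfl⟩, h⟩
    · rintro _ ⟨X, hX, rfl⟩
      exact hφ X hX
    · rintro _ ⟨X, hX, rfl⟩
      exact hψ X hX
  | ex x φ ih =>
    intro C h
    choose! F hF hφ using h
    -- The condition `s ∈ X` is essential: `F X s` is constrained only for members of `X`.
    refine ⟨fun s => {a | ∃ X ∈ C, s ∈ X ∧ a ∈ F X s}, ?_, ?_⟩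
    · rintro s ⟨X, hX, hs⟩
      obtain ⟨a, ha⟩ := hF X hX s hs
      exact ⟨a, X, hX, hs, ha⟩
    · have : supplement (⋃₀ C) x (fun s => {a | ∃ X ∈ C, s ∈ X ∧ a ∈ F X s}) =
          ⋃₀ ((fun X => supplement X x (F X)) '' C) := by
        ext t
        constructor
        · rintro ⟨s, -, a, ⟨X, hX, hs, ha⟩, rfl⟩
          exact ⟨_, ⟨X, hX, rfl⟩, s, hs, a, ha, rfl⟩
        · rintro ⟨_, ⟨X, hX, rfl⟩, s, hs, a, ha, rfl⟩
          exact ⟨s, ⟨X, hX, hs⟩, a, ⟨X, hX, hs, ha⟩, rfl⟩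
      rw [this]
      refine ih _ ?_
      rintro _ ⟨X, hX, rfl⟩
      exact hφ X hX
  | all x φ ih =>
    intro C h
    have : supplement (⋃₀ C) x (fun _ => Set.univ) =
        ⋃₀ ((fun X => supplement X x fun _ => Set.univ) '' C) := by
      ext t
      constructor
      · rintro ⟨s, ⟨X, hX, hs⟩, a, ha, rfl⟩
        exact ⟨_, ⟨X, hX, rfl⟩, s, hs, a, ha, rfl⟩
      · rintro ⟨_, ⟨X, hX, rfl⟩, s, hs, a, ha, rfl⟩
        exact ⟨s, ⟨X, hX, hs⟩, a, ha, rfl⟩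
    simp only [Sat]
    rw [this]
    refine ih _ ?_
    rintro _ ⟨X, hX, rfl⟩
    exact h X hX

/-! ### Recursion equations for the greatest satisfying subteam -/

/-- The greatest subteam of `X` that satisfies `φ`. -/
def best {σ : Vocabulary} {A : Type} (S : Struct σ A) (φ : InclFormula σ)
    (X : Set (Assignment A)) : Set (Assignment A) :=
  ⋃₀ {Y | Y ⊆ X ∧ Sat S φ Y}

section best

variable {σ : Vocabulary} {A : Type} (S : Struct σ A)

theorem best_subset (φ : InclFormula σ) (X : Set (Assignment A)) : best S φ X ⊆ X :=
  Set.sUnion_subset fun _ h => h.1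

theorem sat_best (φ : InclFormula σ) (X : Set (Assignment A)) : Sat S φ (best S φ X) :=
  sat_sUnion S φ _ fun _ h => h.2

theorem subset_best {φ : InclFormula σ} {X Y : Set (Assignment A)} (h : Y ⊆ X)
    (hY : Sat S φ Y) : Y ⊆ best S φ X := Set.subset_sUnion_of_mem ⟨h, hY⟩

theorem best_eq {φ : InclFormula σ} {X Z : Set (Assignment A)} (h : Z ⊆ X) (hZ : Sat S φ Z)
    (hmax : ∀ Y ⊆ X, Sat S φ Y → Y ⊆ Z) : best S φ X = Z :=
  (hmax _ (best_subset S φ X) (sat_best S φ X)).antisymm (subset_best S h hZ)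

theorem best_local {φ : InclFormula σ} {P : Assignment A → Prop}
    (h : ∀ X, Sat S φ X ↔ ∀ s ∈ X, P s) (X : Set (Assignment A)) :
    best S φ X = {s | s ∈ X ∧ P s} :=
  best_eq S (fun _ hs => hs.1) ((h _).2 fun _ hs => hs.2)
    fun Y hY hφ s hs => ⟨hY hs, (h Y).1 hφ s hs⟩

/-- The two halves may overlap, so each can be maximized independently of the other. -/
theorem best_or (φ ψ : InclFormula σ) (X : Set (Assignment A)) :
    best S (.or φ ψ) X = best S φ X ∪ best S ψ X := by
  refine best_eq S (Set.union_subset (best_subset S φ X) (best_subset S ψ X)) ?_ ?_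
  · exact ⟨_, _, Set.subset_union_left, Set.subset_union_right, rfl, sat_best S φ X,
      sat_best S ψ X⟩
  · rintro Y hY ⟨Y₁, Y₂, h₁, h₂, rfl, hφ, hψ⟩
    exact Set.union_subset_union (subset_best S (h₁.trans hY) hφ) (subset_best S (h₂.trans hY) hψ)

theorem supplement_subset {X Y : Set (Assignment A)} (h : X ⊆ Y) (x : ℕ)
    (F : Assignment A → Set A) :
    supplement X x F ⊆ supplement Y x fun _ => Set.univ := by
  rintro _ ⟨s, hs, a, -, rfl⟩
  exact ⟨s, h hs, a, trivial, rfl⟩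

/-- The optimal choice gives each assignment every value that leads into the greatest subteam of the
full duplication; the resulting supplement is all of that subteam. -/
theorem best_ex (x : ℕ) (φ : InclFormula σ) (X : Set (Assignment A)) :
    best S (.ex x φ) X =
      {s | s ∈ X ∧ ∃ a, s.supp x a ∈ best S φ (supplement X x fun _ => Set.univ)} := by
  refine best_eq S (fun _ hs => hs.1) ?_ ?_
  · refine ⟨fun s => {a | s.supp x a ∈ best S φ (supplement X x fun _ => Set.univ)},
      fun s hs => hs.2, ?_⟩
    convert sat_best S φ (supplement X x fun _ => Set.univ) using 1
    ext t
    constructor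
    · rintro ⟨s, -, a, ha, rfl⟩
      exact ha
    · intro ht
      obtain ⟨s, hs, a, -, rfl⟩ := best_subset S _ _ ht
      exact ⟨s, ⟨hs, a, ht⟩, a, ht, rfl⟩
  · rintro Y hY ⟨F, hF, hφ⟩ s hs
    obtain ⟨a, ha⟩ := hF s hs
    exact ⟨hY hs, a, subset_best S (supplement_subset hY x F) hφ ⟨s, hs, a, ha, rfl⟩⟩

/-- Until the iteration is stationary, each application loses at least one element. -/
theorem iterate_fixed_of_ncard {α : Type} {f : Set α → Set α} {X : Set α} (hX : X.Finite)
    (hf : ∀ Z ⊆ X, f Z ⊆ Z) {N : ℕ} (hN : X.ncard ≤ N) :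
    f^[N] X ⊆ X ∧ f (f^[N] X) = f^[N] X := by
  induction N generalizing X with
  | zero =>
    obtain rfl : X = ∅ := (Set.ncard_eq_zero hX).1 (by omega)
    exact ⟨subset_rfl, Set.subset_empty_iff.1 (hf ∅ subset_rfl)⟩
  | succ N ih =>
    rw [Function.iterate_succ_apply]
    by_cases h : f X = X
    · rw [h, Function.iterate_fixed h]
      exact ⟨subset_rfl, h⟩
    · have hss : f X ⊂ X := lt_of_le_of_ne (hf X subset_rfl) h
      obtain ⟨h1, h2⟩ := ih (hX.subset hss.1) (fun Z hZ => hf Z (hZ.trans hss.1)) (by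
        have := Set.ncard_lt_ncard hss hX
        omega)
      exact ⟨h1.trans hss.1, h2⟩

/-- The limit satisfies `φ` by `hfix`, and by `hmax` a satisfying subteam survives every round, so
the limit is the greatest one. -/
theorem best_iterate {φ : InclFormula σ} {f : Set (Assignment A) → Set (Assignment A)}
    {X : Set (Assignment A)} (hX : X.Finite) {N : ℕ} (hN : X.ncard ≤ N)
    (hf : ∀ Z, f Z ⊆ Z) (hfix : ∀ Z, f Z = Z → Sat S φ Z)
    (hmax : ∀ Z, ∀ Y ⊆ Z, Sat S φ Y → Y ⊆ f Z) : best S φ X = f^[N] X := by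
  obtain ⟨h1, h2⟩ := iterate_fixed_of_ncard hX (fun Z _ => hf Z) hN
  refine best_eq S h1 (hfix _ h2) fun Y hY hφ => ?_
  clear h1 h2 hN
  induction N with
  | zero => exact hY
  | succ N ih =>
    rw [Function.iterate_succ_apply']
    exact hmax _ _ ih hφ

/-- Satisfaction is not inherited by subteams: cutting down for `ψ` can spoil `φ`, so the two cuts
alternate until both are idle. -/
theorem best_and (φ ψ : InclFormula σ) {X : Set (Assignment A)} (hX : X.Finite) {N : ℕ}
    (hN : X.ncard ≤ N) :
    best S (.and φ ψ) X = (fun Z => best S ψ (best S φ Z))^[N] X := by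
  refine best_iterate S hX hN (fun Z => (best_subset S ψ _).trans (best_subset S φ _)) ?_ ?_
  · intro Z hZ
    -- The fixed point lies in the intermediate team, which lies in `Z`, so all three coincide.
    have h : best S φ Z = Z := (best_subset S φ Z).antisymm (by
      conv_lhs => rw [← hZ]
      exact best_subset S ψ _)
    rw [h] at hZ
    exact ⟨by rw [← h]; exact sat_best S φ Z, by rw [← hZ]; exact sat_best S ψ Z⟩
  · rintro Z Y hY ⟨hφ, hψ⟩
    exact subset_best S (subset_best S hY hφ) hψ

theorem best_incl (m : ℕ) (x y : Fin m → ℕ) {X : Set (Assignment A)} (hX : X.Finite) {N : ℕ}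
    (hN : X.ncard ≤ N) :
    best S (.incl m x y) X =
      (fun Z => {s | s ∈ Z ∧ ∃ t ∈ Z, ∀ j, s (x j) = t (y j)})^[N] X := by
  refine best_iterate S hX hN (fun Z s hs => hs.1) ?_ ?_
  · intro Z hZ s hs
    rw [← hZ] at hs
    exact hs.2
  · intro Z Y hY hφ s hs
    obtain ⟨t, ht, h⟩ := hφ s hs
    exact ⟨hY hs, t, hY ht, h⟩

/-- Losing one extension condemns an assignment together with its remaining extensions, and these
may have supported others; hence the iteration. -/
theorem best_all (x : ℕ) (φ : InclFormula σ) {X : Set (Assignment A)} (hX : X.Finite) {N : ℕ}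
    (hN : X.ncard ≤ N) :
    best S (.all x φ) X =
      (fun Z => {s | s ∈ Z ∧
        ∀ a, s.supp x a ∈ best S φ (supplement Z x fun _ => Set.univ)})^[N] X := by
  refine best_iterate S hX hN (fun Z s hs => hs.1) ?_ ?_
  · intro Z hZ
    have h : best S φ (supplement Z x fun _ => Set.univ) = supplement Z x fun _ => Set.univ := by
      refine (best_subset S φ _).antisymm ?_
      rintro _ ⟨s, hs, a, -, rfl⟩
      rw [← hZ] at hs
      exact hs.2 a
    simp only [Sat]
    rw [← h]
    exact sat_best S φ _
  · intro Z Y hY hφ s hs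
    exact ⟨hY hs, fun a => subset_best S (supplement_subset hY x _) hφ ⟨s, hs, a, trivial, rfl⟩⟩

end best

/-! ### Both solution sets in terms of the greatest team -/

/-- The greatest satisfying team over the free variables. -/
def greatestTeam {σ : Vocabulary} (φ : InclFormula σ) (S : FinStruct σ) :
    Set (Assignment (Fin S.n)) :=
  best S.str φ (fullTeam φ.free (Fin S.n))

theorem isGreatest_greatestTeam {σ : Vocabulary} (φ : InclFormula σ) (S : FinStruct σ) :
    IsGreatest (satTeams φ S.str) (greatestTeam φ S) :=
  ⟨⟨⟨(finite_fullTeam _ _).1.subset (best_subset _ _ _), best_subset _ _ _⟩, sat_best _ _ _⟩,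
    fun _ hX => subset_best _ hX.1.2 hX.2⟩

theorem maxTeams_eq {σ : Vocabulary} (φ : InclFormula σ) (S : FinStruct σ) :
    maxTeams φ S.str = {X | X = greatestTeam φ S ∧ X.Nonempty} := by
  obtain ⟨⟨hT, hsat⟩, hub⟩ := isGreatest_greatestTeam φ S
  ext X
  constructor
  · rintro ⟨hX, hXsat, hne, hmax⟩
    refine ⟨(hub ⟨hX, hXsat⟩).antisymm ?_, hne⟩
    by_contra h
    exact hmax _ hT ⟨hub ⟨hX, hXsat⟩, h⟩ hsat
  · rintro ⟨rfl, hne⟩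
    exact ⟨hT, hsat, hne, fun X' hX' hss h => hss.2 (hub ⟨hX', h⟩)⟩

theorem cardMaxTeams_eq {σ : Vocabulary} (φ : InclFormula σ) (S : FinStruct σ) :
    cardMaxTeams φ S.str = {X | X = greatestTeam φ S ∧ X.Nonempty} := by
  obtain ⟨⟨hT, hsat⟩, hub⟩ := isGreatest_greatestTeam φ S
  ext X
  constructor
  · rintro ⟨hX, hXsat, hne, hmax⟩
    refine ⟨Set.eq_of_subset_of_ncard_le (hub ⟨hX, hXsat⟩) ?_ hT.1, hne⟩
    by_contra h
    exact hmax _ hT (not_le.1 h) hsat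
  · rintro ⟨rfl, hne⟩
    exact ⟨hT, hsat, hne, fun X' hX' hlt h =>
      absurd (Set.ncard_le_ncard (hub ⟨hX', h⟩) hT.1) (not_le.2 hlt)⟩

/-! ### Reading and recognizing encoded structures -/

theorem length_encTuples {n k : ℕ} (R : Set (Fin k → Fin n)) : (encTuples R).length = n ^ k := by
  simp [encTuples]

open Classical in
theorem getElem?_encTuples {n k : ℕ} (R : Set (Fin k → Fin n)) (t : Fin k → Fin n) :
    (encTuples R)[(finFunctionFinEquiv t : ℕ)]? = some (decide (t ∈ R)) := by
  rw [encTuples, List.getElem?_ofFn, dif_pos (finFunctionFinEquiv t).2]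
  simp only [Fin.eta, Equiv.symm_apply_apply]

theorem encTuples_of_length {n k : ℕ} {w : List Bool} (hw : w.length = n ^ k) :
    encTuples {t : Fin k → Fin n | w[(finFunctionFinEquiv t : ℕ)]? = some true} = w := by
  refine List.ext_getElem (by rw [length_encTuples, hw]) fun p hp hp' => ?_
  simp only [encTuples, List.getElem_ofFn, Set.mem_ofPred_eq, Equiv.apply_symm_apply,
    List.getElem?_eq_getElem hp', Option.some.injEq]
  cases w[p] <;> rfl

theorem univSize_append (n : ℕ) (w : List Bool) :
    univSize (List.replicate n true ++ false :: w) = n := by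
  induction n with
  | zero => rfl
  | succ n ih =>
    rw [List.replicate_succ, List.cons_append]
    exact congrArg (· + 1) ih

theorem exists_eq_append {x : List Bool} (hx : univSize x < x.length) :
    ∃ w, x = List.replicate (univSize x) true ++ false :: w := by
  induction x with
  | nil => simp at hx
  | cons b x ih =>
    cases b with
    | false => exact ⟨x, rfl⟩
    | true =>
      have : univSize (true :: x) = univSize x + 1 := rfl
      rw [this] at hx ⊢
      obtain ⟨w, hw⟩ := ih (by simpa using hx)
      exact ⟨w, by rw [List.replicate_succ, List.cons_append, ← hw]⟩

theorem enc_eq {σ : Vocabulary} (S : FinStruct σ) :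
    S.enc = List.replicate S.n true ++
      false :: (List.ofFn fun i : Fin σ.numRel => encTuples (S.str.rel i)).flatten := by
  simp [FinStruct.enc]

theorem univSize_enc {σ : Vocabulary} (S : FinStruct σ) : univSize S.enc = S.n := by
  rw [enc_eq, univSize_append]

theorem map_length_words {σ : Vocabulary} (S : FinStruct σ) :
    (List.ofFn fun i : Fin σ.numRel => encTuples (S.str.rel i)).map List.length =
      (List.ofFn σ.arity).map (S.n ^ ·) := by
  rw [List.map_ofFn, List.map_ofFn]
  congr 1
  funext i
  exact length_encTuples _

theorem length_enc {σ : Vocabulary} (S : FinStruct σ) :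
    S.enc.length = S.n + ((List.ofFn σ.arity).map (S.n ^ ·)).sum + 1 := by
  rw [enc_eq, List.length_append, List.length_cons, List.length_flatten, map_length_words,
    List.length_replicate]
  rfl

theorem getElem?_flatten {α : Type} (L : List (List α)) {i p : ℕ} (w : List α)
    (hi : L[i]? = some w) (hp : p < w.length) :
    L.flatten[((L.take i).map List.length).sum + p]? = w[p]? := by
  induction L generalizing i with
  | nil => simp at hi
  | cons v L ih =>
    cases i with
    | zero =>
      obtain rfl : v = w := by simpa using hi
      simp [List.getElem?_append_left hp]
    | succ i =>
      rw [List.getElem?_cons_succ] at hi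
      rw [List.flatten_cons, List.take_succ_cons, List.map_cons, List.sum_cons, add_assoc,
        List.getElem?_append_right (by omega), Nat.add_sub_cancel_left, ih hi]

-- The summands of the position are the header `1 ^ n 0`, the words of the preceding relations, and
-- the place of the tuple within its own word.
open Classical in
theorem inputSymbol_enc {σ : Vocabulary} (S : FinStruct σ) (i : Fin σ.numRel)
    (t : Fin (σ.arity i) → Fin S.n) :
    inputSymbol S.enc (S.n + 1 + (((List.ofFn σ.arity).take i).map (S.n ^ ·)).sum +
      finFunctionFinEquiv t) = if t ∈ S.str.rel i then 1 else 0 := by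
  have hlen : (((List.ofFn σ.arity).take i).map (S.n ^ ·)) =
      (((List.ofFn fun i : Fin σ.numRel => encTuples (S.str.rel i)).take i).map List.length) := by
    rw [List.map_take, List.map_take, map_length_words]
  have hw := getElem?_flatten (List.ofFn fun i : Fin σ.numRel => encTuples (S.str.rel i))
    (i := i) (p := finFunctionFinEquiv t) (encTuples (S.str.rel i)) (by simp)
    (by rw [length_encTuples]; exact (finFunctionFinEquiv t).2)
  rw [getElem?_encTuples] at hw
  have : S.enc[S.n + 1 + (((List.ofFn σ.arity).take i).map (S.n ^ ·)).sum +
      (finFunctionFinEquiv t : ℕ)]? = some (decide (t ∈ S.str.rel i)) := by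
    have e : S.n + 1 + (((List.ofFn σ.arity).take i).map (S.n ^ ·)).sum +
        (finFunctionFinEquiv t : ℕ) = S.n + ((((List.ofFn σ.arity).take i).map (S.n ^ ·)).sum +
        (finFunctionFinEquiv t : ℕ) + 1) := by ring
    rw [← hw, enc_eq, e, List.getElem?_append_right (by simp), List.length_replicate,
      Nat.add_sub_cancel_left, List.getElem?_cons_succ, hlen]
  unfold inputSymbol
  rw [this]
  by_cases h : t ∈ S.str.rel i <;> simp [h]

/-- Every word of length `n ^ k` is the characteristic word of a relation, so after the header only
the total length matters. The size of the universe is read off from the leading ones. -/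
theorem exists_enc_iff {σ : Vocabulary} (x : List Bool) :
    (∃ S : FinStruct σ, x = S.enc) ↔
      x.length = univSize x + ((List.ofFn σ.arity).map (univSize x ^ ·)).sum + 1 := by
  constructor
  · rintro ⟨S, rfl⟩
    rw [univSize_enc, length_enc]
  · intro hx
    obtain ⟨w, hw⟩ := exists_eq_append (x := x) (by omega)
    set n := univSize x
    set sz := (List.ofFn σ.arity).map (n ^ ·) with hsz
    have hwl : w.length = sz.sum := by
      rw [hw] at hx
      simp only [List.length_append, List.length_replicate, List.length_cons] at hx
      omega
    -- The body is cut into blocks of the prescribed lengths, one for each relation symbol.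
    set ws := sz.splitLengths w with hws
    have hwsl : ws.map List.length = sz := List.map_splitLengths_length _ _ hwl.ge
    have hwslen : ws.length = σ.numRel := by
      rw [← List.length_map (f := List.length), hwsl, hsz, List.length_map, List.length_ofFn]
    refine ⟨⟨n, ⟨fun i => {t | ((ws[(i : ℕ)]?).getD [])[(finFunctionFinEquiv t : ℕ)]? =
      some true}⟩⟩, ?_⟩
    rw [enc_eq]
    dsimp only
    conv_lhs => rw [hw, ← List.flatten_splitLengths w sz hwl.le]
    congr 3
    refine List.ext_getElem (by rw [List.length_ofFn, hwslen]) fun i hi hi' => ?_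
    rw [List.getElem_ofFn]
    have hiR : i < σ.numRel := by simpa using hi'
    have hiw : i < ws.length := hwslen ▸ hiR
    have hlen : ws[i].length = n ^ σ.arity ⟨i, hiR⟩ := by
      have h1 : (ws.map List.length)[i]? = some ws[i].length := by
        rw [List.getElem?_map, List.getElem?_eq_getElem hiw]
        rfl
      rw [hwsl, hsz] at h1
      simpa [hiR, eq_comm] using h1
    have := encTuples_of_length hlen
    simp only [List.getElem?_eq_getElem hiw, Option.getD_some]
    exact this.symm

theorem tupleIdx_val {n k : ℕ} {s : Assignment (Fin n)} {x : Fin k → ℕ} {a : Fin k → Fin n}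
    (h : ∀ j, s (x j) = some (a j)) :
    tupleIdx n (List.ofFn x) s.val = (finFunctionFinEquiv a : ℕ) := by
  rw [tupleIdx_ofFn, finFunctionFinEquiv_apply]
  exact Finset.sum_congr rfl fun j _ => by rw [Assignment.val_of_eq_some (h j)]

theorem exists_tuple {n k : ℕ} {D : Finset ℕ} {s : Assignment (Fin n)}
    (hs : s ∈ fullTeam D (Fin n)) {x : Fin k → ℕ} (hx : ∀ j, x j ∈ D) :
    ∃ a : Fin k → Fin n, ∀ j, s (x j) = some (a j) := by
  choose a ha using fun j => exists_of_mem_fullTeam hs (hx j)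
  exact ⟨a, ha⟩

/-- Positions in memory and in the code are the same base-`n` numbers, so the code of a stored team
is a linear scan of its array. -/
theorem encTeam_storedTeam (n : ℕ) (D : Finset ℕ) (A : ℕ → ℕ) :
    encTeam D (storedTeam n D A) = (List.range (n ^ D.card)).map fun p => decide (0 < A p) := by
  refine List.ext_getElem (by simp [encTeam, length_encTuples]) fun p hp hp' => ?_
  have hpn : p < n ^ D.card := by simpa using hp'
  let t : Fin D.card → Fin n := finFunctionFinEquiv.symm ⟨p, hpn⟩
  have ht : (finFunctionFinEquiv t : ℕ) = p := by simp only [t, Equiv.apply_symm_apply]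
  simp only [encTeam, encTuples, List.getElem_ofFn, List.getElem_map, List.getElem_range,
    Set.mem_ofPred_eq]
  rw [decide_eq_decide]
  have hidx : ∀ s : Assignment (Fin n), (∀ j, s (D.orderEmbOfFin rfl j) = some (t j)) →
      tupleIdx n (varList D) s.val = p := by
    intro s hs
    rw [varList, tupleIdx_val hs, ht]
  constructor
  · rintro ⟨s, hs, h⟩
    have := hs.2
    rwa [hidx s h] at this
  · intro hA
    let s : Assignment (Fin n) := fun v =>
      if h : v ∈ D then some (t ((D.orderIsoOfFin rfl).symm ⟨v, h⟩)) else none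
    have hs : ∀ j, s (D.orderEmbOfFin rfl j) = some (t j) := by
      intro j
      have hm := D.orderEmbOfFin_mem rfl j
      have : (⟨D.orderEmbOfFin rfl j, hm⟩ : D) = D.orderIsoOfFin rfl j :=
        Subtype.ext (D.coe_orderIsoOfFin_apply rfl j).symm
      simp only [s, dif_pos hm, this, OrderIso.symm_apply_apply]
    refine ⟨s, ⟨fun v => by simp [s], ?_⟩, hs⟩
    rwa [hidx s hs]

theorem nonempty_storedTeam (n : ℕ) (D : Finset ℕ) (A : ℕ → ℕ) :
    (storedTeam n D A).Nonempty ↔ 0 < ∑ p ∈ Finset.range (n ^ D.card), A p := by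
  rw [Finset.sum_pos_iff]
  constructor
  · rintro ⟨s, hs, h⟩
    refine ⟨_, Finset.mem_range.2 ?_, h⟩
    rw [← length_varList D]
    exact tupleIdx_lt (mem_envs.1 (val_mem_envs hs)).1
  · rintro ⟨p, hp, hA⟩
    have hp' := Finset.mem_range.1 hp
    have htrue : true ∈ encTeam D (storedTeam n D A) := by
      rw [encTeam_storedTeam, List.mem_map]
      exact ⟨p, List.mem_range.2 hp', by simpa using hA⟩
    simp only [encTeam, encTuples, List.mem_ofFn] at htrue
    obtain ⟨j, hj⟩ := htrue
    simp only [decide_eq_true_eq] at hj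
    obtain ⟨s, hs, -⟩ := hj
    exact ⟨s, hs⟩

/-! ### Computing the greatest satisfying subteam -/

/-- The greatest subteam that satisfies `φ` is computed in place, for teams with domain `D` stored
in the array `q`. -/
def ComputesBest {σ : Vocabulary} (φ : InclFormula σ) (D : Finset ℕ) (q : ℕ) : Prop :=
  ∃ h, ImplA h ∧ ∀ (S : FinStruct σ) (d : Data), d.Preserves q (h S.enc (fun _ => 0) d) ∧
    storedTeam S.n D ((h S.enc (fun _ => 0) d).arr q) = best S.str φ (storedTeam S.n D (d.arr q))

theorem ComputesBest.of_local {σ : Vocabulary} {φ : InclFormula σ} {D : Finset ℕ} {q : ℕ}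
    (hq : 0 < q) {g : List Bool → (ℕ → ℕ) → ℕ} (hg : ImplV fun x _ u => g x u)
    (P : (S : FinStruct σ) → Assignment (Fin S.n) → Prop)
    (hP : ∀ S X, Sat S.str φ X ↔ ∀ s ∈ X, P S s)
    (hgP : ∀ S : FinStruct σ, ∀ s ∈ fullTeam D (Fin S.n), 0 < g S.enc s.val ↔ P S s) :
    ComputesBest φ D q := by
  obtain ⟨h, H, hs⟩ := exists_filter hq D hg fun _ _ _ _ _ => rfl
  refine ⟨h, H, fun S d => ?_⟩
  obtain ⟨h1, h2⟩ := hs S.enc S.n (univSize_enc S) d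
  refine ⟨h1, ?_⟩
  rw [h2, best_local S.str (hP S)]
  ext s
  exact and_congr_right fun hs => hgP S s hs.1

/-- With truncated subtraction this is the distance of the two values, positive exactly when they
differ. -/
theorem ImplV.diff (x y : ℕ) : ImplV fun _ _ u => (u x - u y) + (u y - u x) :=
  ((ImplV.var x).sub (.var y)).add ((ImplV.var y).sub (.var x))

theorem val_eq_val_iff {n : ℕ} {D : Finset ℕ} {s : Assignment (Fin n)}
    (hs : s ∈ fullTeam D (Fin n)) {x y : ℕ} (hx : x ∈ D) (hy : y ∈ D) :
    s.val x = s.val y ↔ s x = s y := by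
  obtain ⟨a, ha⟩ := exists_of_mem_fullTeam hs hx
  obtain ⟨b, hb⟩ := exists_of_mem_fullTeam hs hy
  rw [Assignment.val_of_eq_some ha, Assignment.val_of_eq_some hb, ha, hb, Option.some_inj,
    Fin.ext_iff]

theorem ComputesBest.eq {σ : Vocabulary} (x y : ℕ) {D : Finset ℕ}
    (hD : (InclFormula.eq x y : InclFormula σ).free ⊆ D) {q : ℕ} (hq : 0 < q) :
    ComputesBest (.eq x y : InclFormula σ) D q := by
  refine .of_local hq (g := fun _ u => 1 - ((u x - u y) + (u y - u x)))
    ((ImplV.const 1).sub (.diff x y)) (fun _ s => s x = s y)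
    (fun _ _ => Iff.rfl) fun S s hs => ?_
  rw [← val_eq_val_iff hs (hD (by simp [InclFormula.free])) (hD (by simp [InclFormula.free]))]
  omega

theorem ComputesBest.neq {σ : Vocabulary} (x y : ℕ) {D : Finset ℕ}
    (hD : (InclFormula.neq x y : InclFormula σ).free ⊆ D) {q : ℕ} (hq : 0 < q) :
    ComputesBest (.neq x y : InclFormula σ) D q := by
  refine .of_local hq (.diff x y) (fun _ s => s x ≠ s y) (fun _ _ => Iff.rfl) fun S s hs => ?_
  rw [Ne, ← val_eq_val_iff hs (hD (by simp [InclFormula.free])) (hD (by simp [InclFormula.free]))]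
  omega

/-- The input symbol that tells whether an atom with relation `i` holds. -/
def atomSymbol (σ : Vocabulary) (i : Fin σ.numRel) (x : Fin (σ.arity i) → ℕ) (w : List Bool)
    (u : ℕ → ℕ) : ℕ :=
  inputSymbol w (univSize w + 1 + (((List.ofFn σ.arity).take i).map (univSize w ^ ·)).sum +
    tupleIdx (univSize w) (List.ofFn x) u)

theorem ImplV.atomSymbol (σ : Vocabulary) (i : Fin σ.numRel) (x : Fin (σ.arity i) → ℕ) :
    ImplV fun w _ u => atomSymbol σ i x w u := by
  have h : ImplV fun w _ _ => univSize w := by simpa using ImplV.pow 1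
  exact (((h.add (.const 1)).add (.powSum _)).add (.tupleIdx _)).inp

theorem atomSymbol_pos_iff {σ : Vocabulary} (S : FinStruct σ) (i : Fin σ.numRel)
    {x : Fin (σ.arity i) → ℕ} {D : Finset ℕ} (hx : ∀ j, x j ∈ D) {s : Assignment (Fin S.n)}
    (hs : s ∈ fullTeam D (Fin S.n)) :
    0 < atomSymbol σ i x S.enc s.val ↔ ∃ a ∈ S.str.rel i, ∀ j, s (x j) = some (a j) := by
  obtain ⟨a, ha⟩ := exists_tuple hs hx
  rw [atomSymbol, univSize_enc, tupleIdx_val ha, inputSymbol_enc]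
  constructor
  · intro h
    by_contra hc
    have : a ∉ S.str.rel i := fun h' => hc ⟨a, h', ha⟩
    simp [this] at h
  · rintro ⟨b, hb, hsb⟩
    obtain rfl : a = b := funext fun j => Option.some_inj.1 ((ha j).symm.trans (hsb j))
    simp [hb]

theorem ComputesBest.rel {σ : Vocabulary} (i : Fin σ.numRel) (x : Fin (σ.arity i) → ℕ)
    {D : Finset ℕ} (hD : (InclFormula.rel i x).free ⊆ D) {q : ℕ} (hq : 0 < q) :
    ComputesBest (.rel i x) D q :=
  .of_local hq (.atomSymbol σ i x) (fun S s => ∃ a ∈ S.str.rel i, ∀ j, s (x j) = some (a j))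
    (fun _ _ => Iff.rfl) fun S _ hs =>
      atomSymbol_pos_iff S i (fun j => hD (by simp [InclFormula.free])) hs

theorem ComputesBest.nrel {σ : Vocabulary} (i : Fin σ.numRel) (x : Fin (σ.arity i) → ℕ)
    {D : Finset ℕ} (hD : (InclFormula.nrel i x).free ⊆ D) {q : ℕ} (hq : 0 < q) :
    ComputesBest (.nrel i x) D q := by
  refine .of_local hq (g := fun w u => 1 - atomSymbol σ i x w u)
    ((ImplV.const 1).sub (.atomSymbol σ i x))
    (fun S s => ¬ ∃ a ∈ S.str.rel i, ∀ j, s (x j) = some (a j)) (fun _ _ => Iff.rfl)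
    fun S s hs => ?_
  rw [← atomSymbol_pos_iff S i (fun j => hD (by simp [InclFormula.free])) hs]
  omega

/-- Any upper bound on the cardinality may serve as number of rounds; this one is the count provided
by `ImplA.repeatSuccPow`. -/
theorem ncard_storedTeam_le (n : ℕ) (D : Finset ℕ) (A : ℕ → ℕ) :
    (storedTeam n D A).Finite ∧ (storedTeam n D A).ncard ≤ (n + 1) ^ D.card := by
  obtain ⟨h1, h2⟩ := finite_fullTeam D n
  exact ⟨h1.subset (storedTeam_subset n D A), (Set.ncard_le_ncard (storedTeam_subset n D A) h1).trans
    (h2.trans (Nat.pow_le_pow_left (Nat.le_succ n) _))⟩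

/-- If the greatest subteam is obtained by iterating an operation that is computed in place, then
it is computed in place. -/
theorem ComputesBest.of_step {σ : Vocabulary} {φ : InclFormula σ} {D : Finset ℕ} {q : ℕ}
    {h : List Bool → (ℕ → ℕ) → Data → Data} (H : ImplA h)
    (F : (S : FinStruct σ) → Set (Assignment (Fin S.n)) → Set (Assignment (Fin S.n)))
    (hF : ∀ (S : FinStruct σ) (d : Data), d.Preserves q (h S.enc (fun _ => 0) d) ∧
      storedTeam S.n D ((h S.enc (fun _ => 0) d).arr q) = F S (storedTeam S.n D (d.arr q)))
    (hbest : ∀ (S : FinStruct σ) (X : Set (Assignment (Fin S.n))), X.Finite →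
      ∀ N, X.ncard ≤ N → best S.str φ X = (F S)^[N] X) :
    ComputesBest φ D q := by
  refine ⟨_, H.repeatSuccPow D.card, fun S d => ?_⟩
  obtain ⟨h1, h2⟩ := ncard_storedTeam_le S.n D (d.arr q)
  rw [hbest S _ h1 _ h2, univSize_enc]
  exact iterate_storedTeam (hF S) _ _

theorem ComputesBest.and {σ : Vocabulary} {φ ψ : InclFormula σ} {D : Finset ℕ} {q : ℕ}
    (hφ : ComputesBest φ D q) (hψ : ComputesBest ψ D q) : ComputesBest (.and φ ψ) D q := by
  obtain ⟨h, H, hs⟩ := hφ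
  obtain ⟨h', H', hs'⟩ := hψ
  refine .of_step (H'.comp H) (fun S Z => best S.str ψ (best S.str φ Z)) (fun S d => ?_)
    fun S X hX N hN => best_and S.str φ ψ hX hN
  obtain ⟨h1, h2⟩ := hs S d
  obtain ⟨h1', h2'⟩ := hs' S (h S.enc (fun _ => 0) d)
  exact ⟨h1.trans h1', by rw [h2', h2]⟩

theorem exists_copy {p : ℕ} (hp : 0 < p) {q : ℕ} (hq : 0 < q) (D : Finset ℕ) :
    ∃ h, ImplA h ∧ ∀ (x : List Bool) (n : ℕ), univSize x = n → ∀ d : Data,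
      d.Preserves q (h x (fun _ => 0) d) ∧
      (∀ r, 0 < r → r ≠ q → (h x (fun _ => 0) d).arr r = d.arr r) ∧
      storedTeam n D ((h x (fun _ => 0) d).arr q) = storedTeam n D (d.arr p) := by
  obtain ⟨h, H, hs⟩ := exists_assign hq D ((ImplV.tupleIdx (varList D)).arr p)
    (fun x A A' u h => by simp only [h p hp.ne'])
  refine ⟨h, H, fun x n hn d => ?_⟩
  subst hn
  exact hs x _ rfl d

/-- The team is copied for each disjunct. The first result in `q + 1` survives because the second
computation, based at `q + 2`, preserves all lower arrays except the buffer; the original in `q`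
stays available for the second copy. -/
theorem ComputesBest.or {σ : Vocabulary} {φ ψ : InclFormula σ} {D : Finset ℕ} {q : ℕ} (hq : 0 < q)
    (hφ : ComputesBest φ D (q + 1)) (hψ : ComputesBest ψ D (q + 2)) :
    ComputesBest (.or φ ψ) D q := by
  obtain ⟨h₁, H₁, s₁⟩ := exists_copy hq (q := q + 1) (by omega) D
  obtain ⟨h₂, H₂, s₂⟩ := hφ
  obtain ⟨h₃, H₃, s₃⟩ := exists_copy hq (q := q + 2) (by omega) D
  obtain ⟨h₄, H₄, s₄⟩ := hψ
  obtain ⟨h₅, H₅, s₅⟩ := exists_assign hq D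
    (((ImplV.tupleIdx (varList D)).arr (q + 1)).add ((ImplV.tupleIdx (varList D)).arr (q + 2)))
    (fun x A A' u h => by simp only [h (q + 1) (by omega), h (q + 2) (by omega)])
  refine ⟨_, H₅.comp (H₄.comp (H₃.comp (H₂.comp H₁))), fun S d₀ => ?_⟩
  have hn := univSize_enc S
  obtain ⟨d₁, hd₁⟩ : ∃ d, d = h₁ S.enc (fun _ => 0) d₀ := ⟨_, rfl⟩
  obtain ⟨d₂, hd₂⟩ : ∃ d, d = h₂ S.enc (fun _ => 0) d₁ := ⟨_, rfl⟩
  obtain ⟨d₃, hd₃⟩ : ∃ d, d = h₃ S.enc (fun _ => 0) d₂ := ⟨_, rfl⟩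
  obtain ⟨d₄, hd₄⟩ : ∃ d, d = h₄ S.enc (fun _ => 0) d₃ := ⟨_, rfl⟩
  obtain ⟨p₁, -, t₁⟩ := s₁ S.enc S.n hn d₀
  obtain ⟨p₂, t₂⟩ := s₂ S d₁
  obtain ⟨p₃, r₃, t₃⟩ := s₃ S.enc S.n hn d₂
  obtain ⟨p₄, t₄⟩ := s₄ S d₃
  obtain ⟨p₅, -, t₅⟩ := s₅ S.enc S.n hn d₄
  rw [← hd₁, ← hd₂, ← hd₃, ← hd₄]
  rw [← hd₁] at p₁ t₁
  rw [← hd₂] at p₂ t₂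
  rw [← hd₃] at p₃ r₃ t₃
  rw [← hd₄] at p₄ t₄
  refine ⟨(((((p₁.mono (by omega)).trans (p₂.mono (by omega))).trans (p₃.mono (by omega))).trans
    (p₄.mono (by omega))).trans p₅), ?_⟩
  have e₁ : storedTeam S.n D (d₄.arr (q + 1)) = best S.str φ (storedTeam S.n D (d₀.arr q)) := by
    rw [p₄.arr _ (by omega) (by omega), r₃ _ (by omega) (by omega), t₂, t₁]
  have e₂ : storedTeam S.n D (d₄.arr (q + 2)) = best S.str ψ (storedTeam S.n D (d₀.arr q)) := by
    rw [t₄, t₃, p₂.arr _ hq (by omega), p₁.arr _ hq (by omega)]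
  rw [t₅, best_or, ← e₁, ← e₂, hn]
  ext s
  simp only [storedTeam, Set.mem_union, Set.mem_ofPred_eq, ← and_or_left]
  refine and_congr_right fun _ => ?_
  omega

theorem ComputesBest.incl {σ : Vocabulary} (m : ℕ) (x y : Fin m → ℕ) {D : Finset ℕ}
    (hD : (InclFormula.incl m x y : InclFormula σ).free ⊆ D) {q : ℕ} (hq : 0 < q) :
    ComputesBest (.incl m x y : InclFormula σ) D q := by
  have hx : ∀ j, x j ∈ D := fun j => hD (by simp [InclFormula.free])
  have hy : ∀ j, y j ∈ D := fun j => hD (by simp [InclFormula.free])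
  -- Array `q + 1` becomes a table of the `y`-tuples of the team. Only positions of `x`-tuples are
  -- cleared beforehand, since the filter looks up no others.
  obtain ⟨h₁, H₁, s₁⟩ := exists_scatter (q + 1) 0 (varList D) (.tupleIdx (List.ofFn x)) (.const 1)
    fun _ _ _ _ _ => rfl
  obtain ⟨h₂, H₂, s₂⟩ := exists_scatter (q + 1) 1 (varList D) (.tupleIdx (List.ofFn y))
    ((ImplV.tupleIdx (varList D)).arr q) (fun x A A' u h => by simp only [h q (by omega)])
  obtain ⟨h₃, H₃, s₃⟩ := exists_filter hq D ((ImplV.tupleIdx (List.ofFn x)).arr (q + 1))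
    (fun x A A' u h => by simp only [h (q + 1) (by omega)])
  refine .of_step (H₃.comp (H₂.comp H₁))
    (fun S Z => {s | s ∈ Z ∧ ∃ t ∈ Z, ∀ j, s (x j) = t (y j)}) (fun S d₀ => ?_)
    fun S X hX N hN => best_incl S.str m x y hX hN
  have hn := univSize_enc S
  obtain ⟨d₁, hd₁⟩ : ∃ d, d = h₁ S.enc (fun _ => 0) d₀ := ⟨_, rfl⟩
  obtain ⟨d₂, hd₂⟩ : ∃ d, d = h₂ S.enc (fun _ => 0) d₁ := ⟨_, rfl⟩
  obtain ⟨a₁, b₁, c₁, t₁⟩ := s₁ S.enc (fun _ => 0) d₀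
  obtain ⟨a₂, b₂, c₂, t₂⟩ := s₂ S.enc (fun _ => 0) d₁
  obtain ⟨p₃, t₃⟩ := s₃ S.enc S.n hn d₂
  rw [← hd₁, ← hd₂]
  rw [← hd₁] at a₁ b₁ c₁ t₁
  rw [← hd₂] at a₂ b₂ c₂ t₂
  rw [hn] at t₁ t₂ t₃
  refine ⟨Data.Preserves.trans ⟨a₂.trans a₁, b₂.trans b₁, fun r _ hr => ?_⟩ p₃, t₃.trans ?_⟩
  · rw [c₂ r (by omega), c₁ r (by omega)]
  have hq₂ : d₂.arr q = d₀.arr q := by rw [c₂ q (by omega), c₁ q (by omega)]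
  rw [hq₂]
  ext s
  refine and_congr_right fun hs => ?_
  obtain ⟨a, ha⟩ := exists_tuple hs.1 hx
  have h0 : d₁.arr (q + 1) (tupleIdx S.n (List.ofFn x) s.val) = 0 := by
    rw [t₁, if_pos ⟨s.val, val_mem_envs hs.1, one_pos, rfl⟩]
  rw [t₂, h0, c₁ q (by omega)]
  have key : (∃ u' ∈ envs S.n (varList D) (fun _ => 0),
      0 < d₀.arr q (tupleIdx S.n (varList D) u') ∧
        tupleIdx S.n (List.ofFn y) u' = tupleIdx S.n (List.ofFn x) s.val) ↔
      ∃ t ∈ storedTeam S.n D (d₀.arr q), ∀ j, s (x j) = t (y j) := by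
    constructor
    · rintro ⟨u', hu', hpos, he⟩
      obtain ⟨t, ht, rfl⟩ := exists_val_eq hu'
      obtain ⟨b, hb⟩ := exists_tuple ht hy
      refine ⟨t, ⟨ht, hpos⟩, fun j => ?_⟩
      rw [tupleIdx_val ha, tupleIdx_val hb] at he
      rw [ha, hb, finFunctionFinEquiv.injective (Fin.ext he)]
    · rintro ⟨t, ht, he⟩
      refine ⟨t.val, val_mem_envs ht.1, ht.2, ?_⟩
      rw [tupleIdx_val ha, tupleIdx_val (a := a) fun j => (he j).symm.trans (ha j)]
  rw [← key]
  split
  next h => exact iff_of_true one_pos h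
  next h => exact iff_of_false (lt_irrefl 0) h

theorem supp_mem_fullTeam {A : Type} {D : Finset ℕ} {s : Assignment A} (hs : s ∈ fullTeam D A)
    (x : ℕ) (a : A) : s.supp x a ∈ fullTeam (insert x D) A := by
  intro v
  by_cases hv : v = x
  · simp [Assignment.supp, hv]
  · simp only [Assignment.supp, Function.update_of_ne hv, Finset.mem_insert, hv, false_or]
    exact hs v

/-- The sum asks whether some value of `x` leads back to a stored assignment. If `x ∈ D`, that value
is the one overwritten; if `x ∉ D`, the summands do not depend on it. -/
theorem supplement_storedTeam (n : ℕ) (D : Finset ℕ) (A : ℕ → ℕ) (x : ℕ) :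
    supplement (storedTeam n D A) x (fun _ => Set.univ) =
      {t | t ∈ fullTeam (insert x D) (Fin n) ∧
        0 < ∑ a ∈ Finset.range n, A (tupleIdx n (varList D) (Function.update t.val x a))} := by
  ext t
  simp only [Set.mem_ofPred_eq, Finset.sum_pos_iff, Finset.mem_range]
  constructor
  · rintro ⟨s, ⟨hs, hpos⟩, b, -, rfl⟩
    refine ⟨supp_mem_fullTeam hs x b, ?_⟩
    by_cases hx : x ∈ D
    · obtain ⟨a, ha⟩ := exists_of_mem_fullTeam hs hx
      refine ⟨a, a.2, ?_⟩
      rw [Assignment.val_supp, Function.update_idem, ← Assignment.val_of_eq_some ha,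
        Function.update_eq_self]
      exact hpos
    · refine ⟨b, b.2, ?_⟩
      rw [Assignment.val_supp, Function.update_idem, tupleIdx_congr n (u' := s.val)]
      · exact hpos
      · intro v hv
        refine Function.update_of_ne ?_ _ _
        rintro rfl
        exact hx (mem_varList.1 hv)
  · rintro ⟨ht, a, ha, hpos⟩
    obtain ⟨b, hb⟩ := exists_of_mem_fullTeam ht (Finset.mem_insert_self x D)
    -- The preimage of `t`: the old value is restored, or `x` is removed from the domain.
    let s : Assignment (Fin n) := Function.update t x (if x ∈ D then some ⟨a, ha⟩ else none)
    have hs : s ∈ fullTeam D (Fin n) := by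
      intro v
      by_cases hv : v = x
      · subst hv
        simp [s]
      · simp only [s, Function.update_of_ne hv]
        rw [ht v, Finset.mem_insert]
        simp [hv]
    refine ⟨s, ⟨hs, ?_⟩, b, trivial, ?_⟩
    · rw [tupleIdx_congr n (u' := Function.update t.val x a)]
      · exact hpos
      · intro v hv
        by_cases hvx : v = x
        · subst hvx
          rw [Function.update_self]
          exact Assignment.val_of_eq_some (a := ⟨a, ha⟩) (by simp [s, mem_varList.1 hv])
        · simp [s, Assignment.val, hvx]
    · simp only [s, Assignment.supp, Function.update_idem]
      rw [← hb, Function.update_eq_self]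

/-- After this the array `q + 1` contains the greatest satisfying subteam of the duplication of
the team in the array `q`. -/
theorem ComputesBest.exists_duplicate {σ : Vocabulary} {φ : InclFormula σ} {x : ℕ} {D : Finset ℕ}
    {q : ℕ} (hq : 0 < q) (hφ : ComputesBest φ (insert x D) (q + 1)) :
    ∃ h, ImplA h ∧ ∀ (S : FinStruct σ) (d : Data),
      d.Preserves (q + 1) (h S.enc (fun _ => 0) d) ∧
      storedTeam S.n (insert x D) ((h S.enc (fun _ => 0) d).arr (q + 1)) =
        best S.str φ (supplement (storedTeam S.n D (d.arr q)) x fun _ => Set.univ) := by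
  obtain ⟨h₁, H₁, s₁⟩ := exists_assign (q := q + 1) (by omega) (insert x D)
    (((ImplV.tupleIdx (varList D)).arr q).sum x) (fun x A A' u h => by simp only [h q (by omega)])
  obtain ⟨h₂, H₂, s₂⟩ := hφ
  refine ⟨_, H₂.comp H₁, fun S d => ?_⟩
  have hn := univSize_enc S
  obtain ⟨p₁, -, t₁⟩ := s₁ S.enc S.n hn d
  obtain ⟨p₂, t₂⟩ := s₂ S (h₁ S.enc (fun _ => 0) d)
  refine ⟨p₁.trans p₂, t₂.trans ?_⟩
  rw [t₁, hn, supplement_storedTeam]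

theorem mem_storedTeam_supp {n : ℕ} {D : Finset ℕ} {s : Assignment (Fin n)}
    (hs : s ∈ fullTeam D (Fin n)) (A : ℕ → ℕ) (x : ℕ) (a : Fin n) :
    s.supp x a ∈ storedTeam n (insert x D) A ↔
      0 < A (tupleIdx n (varList (insert x D)) (Function.update s.val x a)) := by
  rw [← Assignment.val_supp]
  exact and_iff_right (supp_mem_fullTeam hs x a)

theorem ComputesBest.ex {σ : Vocabulary} {φ : InclFormula σ} {x : ℕ} {D : Finset ℕ}
    {q : ℕ} (hq : 0 < q) (hφ : ComputesBest φ (insert x D) (q + 1)) :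
    ComputesBest (.ex x φ) D q := by
  obtain ⟨h₁, H₁, s₁⟩ := hφ.exists_duplicate hq
  obtain ⟨h₂, H₂, s₂⟩ := exists_filter hq D
    (((ImplV.tupleIdx (varList (insert x D))).arr (q + 1)).sum x)
    (fun x A A' u h => by simp only [h (q + 1) (by omega)])
  refine ⟨_, H₂.comp H₁, fun S d => ?_⟩
  have hn := univSize_enc S
  obtain ⟨p₁, t₁⟩ := s₁ S d
  obtain ⟨p₂, t₂⟩ := s₂ S.enc S.n hn (h₁ S.enc (fun _ => 0) d)
  refine ⟨(p₁.mono (by omega)).trans p₂, t₂.trans ?_⟩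
  rw [best_ex, ← t₁, p₁.arr q hq (by omega), hn]
  ext s
  refine and_congr_right fun hs => ?_
  rw [Finset.sum_pos_iff]
  simp only [Finset.mem_range]
  exact ⟨fun ⟨a, ha, h⟩ => ⟨⟨a, ha⟩, (mem_storedTeam_supp hs.1 _ _ _).2 h⟩,
    fun ⟨a, h⟩ => ⟨a, a.2, (mem_storedTeam_supp hs.1 _ _ _).1 h⟩⟩

theorem ComputesBest.all {σ : Vocabulary} {φ : InclFormula σ} {x : ℕ} {D : Finset ℕ}
    {q : ℕ} (hq : 0 < q) (hφ : ComputesBest φ (insert x D) (q + 1)) :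
    ComputesBest (.all x φ) D q := by
  obtain ⟨h₁, H₁, s₁⟩ := hφ.exists_duplicate hq
  -- Double negation: the inner sum counts the values whose extension is missing, and the outer
  -- difference is positive exactly when there are none.
  obtain ⟨h₂, H₂, s₂⟩ := exists_filter hq D ((ImplV.const 1).sub (((ImplV.const 1).sub
    ((ImplV.tupleIdx (varList (insert x D))).arr (q + 1))).sum x))
    (fun x A A' u h => by simp only [h (q + 1) (by omega)])
  refine .of_step (H₂.comp H₁)
    (fun S Z => {s | s ∈ Z ∧
        ∀ a, s.supp x a ∈ best S.str φ (supplement Z x fun _ => Set.univ)}) (fun S d => ?_)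
    fun S X hX N hN => best_all S.str x φ hX hN
  have hn := univSize_enc S
  obtain ⟨p₁, t₁⟩ := s₁ S d
  obtain ⟨p₂, t₂⟩ := s₂ S.enc S.n hn (h₁ S.enc (fun _ => 0) d)
  refine ⟨(p₁.mono (by omega)).trans p₂, t₂.trans ?_⟩
  rw [← t₁, p₁.arr q hq (by omega), hn]
  ext s
  refine and_congr_right fun hs => ?_
  rw [Nat.sub_pos_iff_lt, Nat.lt_one_iff, Finset.sum_eq_zero_iff]
  simp only [Finset.mem_range, Nat.sub_eq_zero_iff_le]
  exact ⟨fun h a => (mem_storedTeam_supp hs.1 _ _ _).2 (h a a.2),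
    fun h a ha => (mem_storedTeam_supp hs.1 _ _ _).1 (h ⟨a, ha⟩)⟩

/-- The domain is arbitrary above the free variables because quantifiers enlarge it, and the array
is arbitrary because immediate subformulas of disjunctions and quantifiers work in fresh ones. -/
theorem computesBest {σ : Vocabulary} (φ : InclFormula σ) :
    ∀ (D : Finset ℕ) (q : ℕ), φ.free ⊆ D → 0 < q → ComputesBest φ D q := by
  induction φ with
  | eq x y => exact fun D q hD hq => .eq x y hD hq
  | neq x y => exact fun D q hD hq => .neq x y hD hq
  | rel i x => exact fun D q hD hq => .rel i x hD hq
  | nrel i x => exact fun D q hD hq => .nrel i x hD hq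
  | incl m x y => exact fun D q hD hq => .incl m x y hD hq
  | and φ ψ ihφ ihψ =>
    exact fun D q hD hq => .and (ihφ D q (Finset.union_subset_left hD) hq)
      (ihψ D q (Finset.union_subset_right hD) hq)
  | or φ ψ ihφ ihψ =>
    exact fun D q hD hq => .or hq (ihφ D (q + 1) (Finset.union_subset_left hD) (by omega))
      (ihψ D (q + 2) (Finset.union_subset_right hD) (by omega))
  | ex x φ ih =>
    exact fun D q hD hq => .ex hq (ih _ _ (Finset.subset_insert_iff.2 hD) (by omega))
  | all x φ ih =>
    exact fun D q hD hq => .all hq (ih _ _ (Finset.subset_insert_iff.2 hD) (by omega))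

/-- The greatest satisfying team is computed in the array `1`. -/
theorem exists_greatestTeam {σ : Vocabulary} (φ : InclFormula σ) :
    ∃ h, ImplA h ∧ ∀ (S : FinStruct σ) (d : Data),
      (h S.enc (fun _ => 0) d).sol = d.sol ∧ (h S.enc (fun _ => 0) d).outs = d.outs ∧
      storedTeam S.n φ.free ((h S.enc (fun _ => 0) d).arr 1) = greatestTeam φ S := by
  obtain ⟨h₁, H₁, s₁⟩ := exists_assign one_pos φ.free (.const 1) fun _ _ _ _ _ => rfl
  obtain ⟨h₂, H₂, s₂⟩ := computesBest φ φ.free 1 subset_rfl one_pos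
  refine ⟨_, H₂.comp H₁, fun S d => ?_⟩
  obtain ⟨p₁, -, t₁⟩ := s₁ S.enc S.n (univSize_enc S) d
  obtain ⟨p₂, t₂⟩ := s₂ S (h₁ S.enc (fun _ => 0) d)
  refine ⟨p₂.sol.trans p₁.sol, p₂.outs.trans p₁.outs, t₂.trans ?_⟩
  rw [t₁, greatestTeam]
  congr 1
  ext s
  simp

/-! ### Writing the team -/

/-- Write the array `1` as the current solution, and the number of its elements, with
multiplicities, into the entry `1` of the array `0`. -/
theorem exists_write (k : ℕ) : ∃ h, ImplA h ∧ ∀ x u (d : Data),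
    (h x u d).outs = d.outs ∧
    (h x u d).sol = d.sol ++ (List.range (univSize x ^ k)).map (fun p => decide (0 < d.arr 1 p)) ∧
    (h x u d).arr 0 1 = ∑ p ∈ Finset.range (univSize x ^ k), d.arr 1 p := by
  -- Entry `0` of the buffer is the scanning position and entry `1` the running sum, which later
  -- decides emptiness through `nonempty_storedTeam`.
  have hpos : ImplV fun _ A _ => A 0 0 := (ImplV.const 0).arr 0
  have hval : ImplV fun _ A _ => A 1 (A 0 0) := hpos.arr 1
  have hstep := (ImplA.store 0 (.const 0) (hpos.add (.const 1))).comp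
    ((ImplA.store 0 (.const 1) (((ImplV.const 1).arr 0).add hval)).comp (ImplA.outBit hval))
  refine ⟨_, (hstep.repeatPow k).comp ((ImplA.store 0 (.const 1) (.const 0)).comp
    (ImplA.store 0 (.const 0) (.const 0))), fun x u d => ?_⟩
  generalize univSize x ^ k = N
  have := iterate_induction (n := N)
    (fun D : Data => let D₁ : Data := { D with sol := D.sol ++ [decide (0 < D.arr 1 (D.arr 0 0))] }
      let D₂ := D₁.setArr 0 1 (D₁.arr 0 1 + D₁.arr 1 (D₁.arr 0 0))
      D₂.setArr 0 0 (D₂.arr 0 0 + 1))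
    (fun i D => D.outs = d.outs ∧ D.arr 1 = d.arr 1 ∧ D.arr 0 0 = i ∧
      D.sol = d.sol ++ (List.range i).map (fun p => decide (0 < d.arr 1 p)) ∧
      D.arr 0 1 = ∑ p ∈ Finset.range i, d.arr 1 p)
    (s := (d.setArr 0 0 0).setArr 0 1 0) (by simp [Data.setArr]) (by
      rintro i D ⟨h1, h2, h3, h4, h5⟩
      refine ⟨h1, ?_, ?_, ?_, ?_⟩
      · simp [Data.setArr, h2]
      · simp [Data.setArr, h3]
      · simp [Data.setArr, h2, h3, h4, List.range_succ]
      · simp [Data.setArr, h2, h3, h5, Finset.sum_range_succ])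
  exact ⟨this.1, this.2.2.2.1, this.2.2.2.2⟩

theorem inputSymbol_sub_one_pos_iff (x : List Bool) (i : ℕ) :
    0 < inputSymbol x i - 1 ↔ x.length ≤ i := by
  rw [← List.getElem?_eq_none_iff]
  unfold inputSymbol
  split <;> simp_all

/-- Recognizing encodings of structures. -/
theorem exists_isEnc (σ : Vocabulary) : ∃ g : List Bool → ℕ, (ImplV fun x _ _ => g x) ∧
    ∀ x, 0 < g x ↔ ∃ S : FinStruct σ, x = S.enc := by
  have h : ImplV fun w _ _ => univSize w := by simpa using ImplV.pow 1
  have hP := h.add (.powSum (List.ofFn σ.arity))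
  let e : List Bool → ℕ := fun x =>
    univSize x + ((List.ofFn σ.arity).map (univSize x ^ ·)).sum
  -- The length is `e x + 1` exactly when position `e x` lies inside the word and the next one
  -- beyond it; two reads decide this.
  refine ⟨fun x => if 0 < inputSymbol x (e x) - 1 then 0 else inputSymbol x (e x + 1) - 1,
    ImplV.ite (hP.inp.sub (.const 1)) (.const 0)
    ((hP.add (.const 1)).inp.sub (.const 1)), fun x => ?_⟩
  rw [exists_enc_iff]
  change 0 < (if 0 < inputSymbol x (e x) - 1 then 0 else inputSymbol x (e x + 1) - 1) ↔
    x.length = e x + 1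
  split
  next h =>
    rw [inputSymbol_sub_one_pos_iff] at h
    omega
  next h =>
    rw [inputSymbol_sub_one_pos_iff] at h
    rw [inputSymbol_sub_one_pos_iff]
    omega

theorem polyTimeComputable_greatestTeam {σ : Vocabulary} (φ : InclFormula σ) :
    PolyTimeComputable FinStruct.enc fun S => encTeam φ.free (greatestTeam φ S) := by
  obtain ⟨h₁, H₁, s₁⟩ := exists_greatestTeam φ
  obtain ⟨h₂, H₂, s₂⟩ := exists_write φ.free.card
  obtain ⟨M, p, hM⟩ := (ImplA.output.comp (H₂.comp H₁)).exists_enumerates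
  refine ⟨M, p, fun S => ?_⟩
  have := hM S.enc
  obtain ⟨a₁, b₁, c₁⟩ := s₁ S Data.init
  obtain ⟨a₂, b₂, -⟩ := s₂ S.enc (fun _ => 0) (h₁ S.enc (fun _ => 0) Data.init)
  dsimp only at this
  rw [a₂, b₁, b₂, a₁, univSize_enc, ← encTeam_storedTeam, c₁] at this
  exact this

open Classical in
/-- A problem whose only solution is the greatest satisfying team, if it is not empty, can be
enumerated with polynomial delay. -/
theorem mem_delP_of_forall {σ : Vocabulary} (φ : InclFormula σ) {E : EnumProblem}
    (hE : ∀ x w, w ∈ E x ↔ ∃ S : FinStruct σ, x = S.enc ∧ (greatestTeam φ S).Nonempty ∧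
      w = encTeam φ.free (greatestTeam φ S)) : E ∈ DelP := by
  obtain ⟨h₁, H₁, s₁⟩ := exists_greatestTeam φ
  obtain ⟨h₂, H₂, s₂⟩ := exists_write φ.free.card
  obtain ⟨g, hg, hgenc⟩ := exists_isEnc σ
  obtain ⟨h, H, hS, hx⟩ : ∃ h, ImplA h ∧
      (∀ S : FinStruct σ, (h S.enc (fun _ => 0) Data.init).outs =
        if (greatestTeam φ S).Nonempty then [encTeam φ.free (greatestTeam φ S)] else []) ∧
      ∀ x, (¬ ∃ S : FinStruct σ, x = S.enc) → (h x (fun _ => 0) Data.init).outs = [] := by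
    -- The outer test makes words that code no structure yield nothing; the inner one suppresses the
    -- empty team, whose word has already been written but not output.
    refine ⟨_, ImplA.ite hg ((ImplA.ite ((ImplV.const 1).arr 0) ImplA.output ImplA.id).comp
      (H₂.comp H₁)) ImplA.id, fun S => ?_, fun x hx => ?_⟩
    · obtain ⟨a₁, b₁, c₁⟩ := s₁ S Data.init
      obtain ⟨a₂, b₂, c₂⟩ := s₂ S.enc (fun _ => 0) (h₁ S.enc (fun _ => 0) Data.init)
      rw [if_pos ((hgenc _).2 ⟨S, rfl⟩)]
      have hne : (greatestTeam φ S).Nonempty ↔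
          0 < (h₂ S.enc (fun _ => 0) (h₁ S.enc (fun _ => 0) Data.init)).arr 0 1 := by
        rw [c₂, univSize_enc, ← c₁, nonempty_storedTeam]
      rw [apply_ite Data.outs]
      simp only [← hne]
      rw [a₂, b₁, b₂, a₁, univSize_enc, ← encTeam_storedTeam, c₁]
      rfl
    · rw [if_neg (fun h => hx ((hgenc _).1 h))]
      rfl
  obtain ⟨M, p, hM⟩ := H.exists_enumerates
  refine ⟨∅, empty_mem_pTime, M, p, fun x => ⟨_, ?_, ?_, hM x⟩⟩
  · by_cases h : ∃ S : FinStruct σ, x = S.enc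
    · obtain ⟨S, rfl⟩ := h
      rw [hS]
      split <;> simp
    · rw [hx x h]
      exact List.nodup_nil
  · ext w
    rw [hE, Set.mem_ofPred_eq]
    constructor
    · intro hw
      by_cases h : ∃ S : FinStruct σ, x = S.enc
      · obtain ⟨S, rfl⟩ := h
        rw [hS] at hw
        split at hw
        next hne => exact ⟨S, rfl, hne, List.mem_singleton.1 hw⟩
        next => simp at hw
      · rw [hx x h] at hw
        simp at hw
    · rintro ⟨S, rfl, hne, rfl⟩
      rw [hS, if_pos hne]
      exact List.mem_singleton_self _

end TeamEnum

open TeamEnum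

theorem mainTheorem10 (σ : Vocabulary) (φ : InclFormula σ) :
    (EMaxSat φ ∈ DelP ∧ ECardMaxSat φ ∈ DelP) ∧
    ∃ T : (S : FinStruct σ) → Set (Assignment (Fin S.n)),
      (∀ S : FinStruct σ,
        IsGreatest (satTeams φ S.str) (T S) ∧
        maxTeams φ S.str = {X | X = T S ∧ X.Nonempty} ∧
        cardMaxTeams φ S.str = {X | X = T S ∧ X.Nonempty}) ∧
      PolyTimeComputable FinStruct.enc (fun S => encTeam φ.free (T S)) := by
  refine ⟨⟨mem_delP_of_forall φ fun x w => ?_, mem_delP_of_forall φ fun x w => ?_⟩,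
    greatestTeam φ, fun S => ⟨isGreatest_greatestTeam φ S, maxTeams_eq φ S, cardMaxTeams_eq φ S⟩,
    polyTimeComputable_greatestTeam φ⟩
  · simp only [EMaxSat, maxTeams_eq, Set.mem_ofPred_eq, and_assoc, exists_eq_left]
  · simp only [ECardMaxSat, cardMaxTeams_eq, Set.mem_ofPred_eq, and_assoc, exists_eq_left]
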